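/- **Conventions.** A graph $\Gamma$ (in the sense of Serre) has a vertex set $\mathrm V\Gamma$, an arc set $\mathrm A\Gamma$, maps $o,t:\mathrm A\Gamma\to\mathrm V\Gamma$ (origin, terminus) and an involution $a\mapsto\bar a$ of $\mathrm A\Gamma$ with $t(\bar a)=o(a)$; *self-reverse* arcs, $\bar a=a$, are allowed. A digraph has no $\bar{\ }$. Morphisms preserve all of this structure. Connected graphs, hence trees, are non-empty; a tree is in particular simple: it has no loops, and an arc is determined by its origin and terminus. A permutation group action $(G,X)$ is a subgroup $G\le\mathrm{Sym}(X)$ with $X\ne\emptyset$. An embedding $(H,Y)\hookrightarrow(G,X)$ is an injection $\Phi:Y\to X$ identifying $H$ with the permutation group induced on $\Phi(Y)$ by its setwise stabiliser in $G$. **Graphs of group actions.** A graph of group actions $\mathcal G$ consists of a connected base graph $\Delta$; a permutation group action $(G(v),X(v))$ for each vertex $v$; a permutation group action $(H(a),Y(a))$ for each arc $a$, with $(H(\bar a),Y(\bar a))=(H(a),Y(a))$; an embedding $\Phi_a:(H(a),Y(a))\hookrightarrow(G(t(a)),X(t(a)))$ for each arc $a$; and, for each self-reverse arc $a$, a permutation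 $h_a$ of $Y(a)$ with $h_aH(a)h_a^{-1}=H(a)$ and $h_a^2\in H(a)$. An $a$-adhesion map is a map $\gamma\Phi_a$ with $\gamma\in G(t(a))$, and an $a$-adhesion set is the image of such a map; for $a$ self-reverse, a twisted $a$-adhesion map is a map $\gamma\Phi_ah_a$ with $\gamma\in G(t(a))$. The augmented base digraph $\Delta_+$ has vertex set $\mathrm V\Delta$ and one arc from $o(a)$ to $t(a)$ for each pair $(a,B)$, where $a\in\mathrm A\Delta$ and $B$ is an $a$-adhesion set; let $\rho(a,B)=a$, and let $\rho$ be the identity on vertices. A $\mathrm{Star}$-covering tree of $\Delta_+$ is a tree $T$ with a surjective digraph morphism $\pi_+:T\to\Delta_+$ (a $\mathrm{Star}$-covering map) that restricts, for every $x\in \mathrm VT$, to a bijection $t^{-1}(x)\to t^{-1}(\pi_+(x))$. **Scaffoldings.** A scaffolding $(\Sigma,\sim,\pi,p)$ for $\mathcal G$ is a graph $\Sigma$ with an equivalence relation $\sim$ on $\mathrm V\Sigma$, extended to arcs by $a\sim a'\iff o(a)\sim o(a')$ and $t(a)\sim t(a')$, such that (write $[x]$ for the class of $x$, and $[\![x]\!]$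 for this class as a vertex or arc of the quotient) 1. $T_\Sigma=\Sigma/{\sim}$ is a tree, and no arc of $\Sigma$ joins two equivalent vertices; 2. $\pi:T_\Sigma\to\Delta$ is a graph morphism; 3. $p$ is a colouring of $\mathrm V\Sigma\cup\mathrm A\Sigma$ that restricts to bijections $[v]\to X(\pi([\![v]\!]))$ and $[a]\to Y(\pi([\![a]\!]))$ for all vertices $v$ and arcs $a$, with $p(\bar a)=p(a)$; 4. let $\Psi_{[\![a]\!]}:Y(\pi([\![a]\!]))\to X(\pi(t([\![a]\!])))$ be given by $\Psi_{[\![a]\!]}(p(c))=p(t(c))$ for $c\in[a]$. If $\pi([\![a]\!])$ is not self-reverse, $\Psi_{[\![a]\!]}$ is a $\pi([\![a]\!])$-adhesion map; if it is self-reverse, one of $\Psi_{[\![a]\!]},\Psi_{[\![\bar a]\!]}$ is a $\pi([\![a]\!])$-adhesion map and the other is a twisted one; 5. for each $[\![v]\!]\in\mathrm VT_\Sigma$, each $b\in\mathrm A\Delta$ with $t(b)=\pi([\![v]\!])$ and each $b$-adhesion set $B$, there is exactly one arc $[\![a]\!]$ of $T_\Sigma$ with $\pi([\![a]\!])=b$,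 $t([\![a]\!])=[\![v]\!]$ and $\Psi_{[\![a]\!]}(p([a]))=B$. The universal group $G$ of $\mathcal G$ (with respect to $\Sigma$) is the group of all automorphisms $g$ of $\Sigma$ that preserve $\sim$ and $\pi$ and such that, for every $[\![v]\!]\in \mathrm VT_\Sigma$, the permutation $g_{[\![v]\!]}$ of $X(\pi([\![v]\!]))$ with $p(g(w))=g_{[\![v]\!]}(p(w))$ for all $w\in[v]$ lies in $G(\pi([\![v]\!]))$. It acts on $T_\Sigma$. **Theorem.** Let $\mathcal G$ be a graph of group actions with base graph $\Delta$. Then $\mathcal G$ has a scaffolding. Let $(\Sigma,\sim,\pi,p)$ be any scaffolding for $\mathcal G$, let $G$ be the universal group and let $T=T_\Sigma$. Then $T$ is the tree associated with $\mathcal G$: it is a $\mathrm{Star}$-covering tree of $\Delta_+$, with a $\mathrm{Star}$-covering map $\pi_+$ satisfying $\rho\pi_+=\pi$. The map $\pi$ is surjective on vertices and on arcs, the $G$-orbits on $\mathrm VT$ and on $\mathrm AT$ are exactly the fibres of $\pi$, and $\pi$ induces a graph isomorphism from the quotient graph $T/G$ onto $\Delta$. -/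

import Mathlib

universe u v w z s r

/-- A digraph: vertices, arcs, origin and terminus (loops and parallel arcs are allowed). -/
structure MultiDigraph where
  V : Type u
  A : Type v
  o : A → V
  t : A → V

namespace MultiDigraph

/-- `Star v`: the arcs with terminus `v`. -/
def star (Γ : MultiDigraph.{u, v}) (x : Γ.V) : Set Γ.A := {a | Γ.t a = x}

/-- The underlying simple graph: distinct vertices joined by an arc in either direction. -/
def underlying (Γ : MultiDigraph.{u, v}) : SimpleGraph Γ.V where
  Adj x y := x ≠ y ∧ ∃ a, (Γ.o a = x ∧ Γ.t a = y) ∨ (Γ.o a = y ∧ Γ.t a = x)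
  symm := ⟨by
    rintro x y ⟨h, a, ha⟩
    exact ⟨h.symm, a, ha.symm⟩⟩
  loopless := ⟨fun _ h => h.1 rfl⟩

/-- Connected, in particular non-empty. -/
def IsConnected (Γ : MultiDigraph.{u, v}) : Prop := Γ.underlying.Connected

/-- No loops, and an arc is determined by its origin and terminus. -/
def IsSimple (Γ : MultiDigraph.{u, v}) : Prop :=
  (∀ a, Γ.o a ≠ Γ.t a) ∧ Function.Injective (fun a => (Γ.o a, Γ.t a))

/-- A digraph morphism. -/
structure Hom (Γ : MultiDigraph.{u, v}) (Λ : MultiDigraph.{w, z}) where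
  onV : Γ.V → Λ.V
  onA : Γ.A → Λ.A
  o_onA : ∀ a, Λ.o (onA a) = onV (Γ.o a)
  t_onA : ∀ a, Λ.t (onA a) = onV (Γ.t a)

end MultiDigraph

/-- A graph in the sense of Serre; arcs with `rev a = a` (self-reverse arcs) are allowed. -/
structure SerreGraph extends MultiDigraph.{u, v} where
  rev : A → A
  rev_rev : ∀ a, rev (rev a) = a
  t_rev : ∀ a, t (rev a) = o a

namespace SerreGraph

theorem o_rev (Γ : SerreGraph.{u, v}) (a : Γ.A) : Γ.o (Γ.rev a) = Γ.t a := by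
  rw [← Γ.t_rev, Γ.rev_rev]

/-- A tree: a simple connected graph without simple cycles of length at least 3. -/
def IsTree (Γ : SerreGraph.{u, v}) : Prop :=
  Γ.toMultiDigraph.IsSimple ∧ Γ.toMultiDigraph.underlying.IsTree

/-- A graph morphism: a digraph morphism that respects reversal. -/
structure Hom (Γ : SerreGraph.{u, v}) (Λ : SerreGraph.{w, z}) extends
    MultiDigraph.Hom Γ.toMultiDigraph Λ.toMultiDigraph where
  rev_onA : ∀ a, Λ.rev (onA a) = onA (Γ.rev a)

/-- A graph isomorphism: a graph morphism that is bijective on vertices and on arcs. -/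
structure Iso (Γ : SerreGraph.{u, v}) (Λ : SerreGraph.{w, z}) where
  onV : Γ.V ≃ Λ.V
  onA : Γ.A ≃ Λ.A
  o_onA : ∀ a, Λ.o (onA a) = onV (Γ.o a)
  t_onA : ∀ a, Λ.t (onA a) = onV (Γ.t a)
  rev_onA : ∀ a, Λ.rev (onA a) = onA (Γ.rev a)

/-- The automorphism group: pairs of a vertex permutation and an arc permutation that form a
graph morphism. -/
def Aut (Γ : SerreGraph.{u, v}) : Subgroup (Equiv.Perm Γ.V × Equiv.Perm Γ.A) where
  carrier := {g | ∀ a, Γ.o (g.2 a) = g.1 (Γ.o a) ∧ Γ.t (g.2 a) = g.1 (Γ.t a) ∧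
    Γ.rev (g.2 a) = g.2 (Γ.rev a)}
  one_mem' := fun _ => ⟨rfl, rfl, rfl⟩
  mul_mem' := by
    intro g h hg hh a
    obtain ⟨h1, h2, h3⟩ := hh a
    obtain ⟨g1, g2, g3⟩ := hg (h.2 a)
    refine ⟨?_, ?_, ?_⟩
    · simpa [h1] using g1
    · simpa [h2] using g2
    · simpa [h3] using g3
  inv_mem' := by
    intro g hg a
    obtain ⟨g1, g2, g3⟩ := hg (g.2⁻¹ a)
    have e : g.2 (g.2⁻¹ a) = a := Equiv.apply_symm_apply g.2 a
    rw [e] at g1 g2 g3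
    refine ⟨?_, ?_, ?_⟩
    · exact (Equiv.symm_apply_eq g.1).2 g1 |>.symm
    · exact (Equiv.symm_apply_eq g.1).2 g2 |>.symm
    · exact (Equiv.symm_apply_eq g.2).2 g3 |>.symm

/-- Two arcs lie on the same edge if they are equal or reverse to each other. -/
def edgeSetoid (Γ : SerreGraph.{u, v}) : Setoid Γ.A where
  r a b := a = b ∨ a = Γ.rev b
  iseqv :=
    { refl := fun _ => Or.inl rfl
      symm := by
        rintro a b (h | h)
        · exact Or.inl h.symm
        · exact Or.inr (by rw [h, Γ.rev_rev])
      trans := by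
        rintro a b c (rfl | rfl) (rfl | rfl)
        · exact Or.inl rfl
        · exact Or.inr rfl
        · exact Or.inr rfl
        · exact Or.inl (Γ.rev_rev _) }

/-- The set of edges `{a, rev a}`. -/
def Edge (Γ : SerreGraph.{u, v}) : Type v := Quotient Γ.edgeSetoid

/-- The edge of an arc. -/
def edge (Γ : SerreGraph.{u, v}) (a : Γ.A) : Γ.Edge := Quotient.mk Γ.edgeSetoid a

/-- A graph equivalence relation. -/
structure Equivalence (Γ : SerreGraph.{u, v}) where
  relV : Setoid Γ.V
  relA : Setoid Γ.A
  o_rel : ∀ a b, relA a b → relV (Γ.o a) (Γ.o b)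
  t_rel : ∀ a b, relA a b → relV (Γ.t a) (Γ.t b)
  rev_rel : ∀ a b, relA a b → relA (Γ.rev a) (Γ.rev b)

/-- The quotient graph of a graph equivalence relation. -/
def quotient (Γ : SerreGraph.{u, v}) (E : Γ.Equivalence) : SerreGraph.{u, v} where
  V := Quotient E.relV
  A := Quotient E.relA
  o := Quotient.map Γ.o E.o_rel
  t := Quotient.map Γ.t E.t_rel
  rev := Quotient.map Γ.rev E.rev_rel
  rev_rev := by
    intro a
    induction a using Quotient.inductionOn with
    | h a => exact congrArg (Quotient.mk E.relA) (Γ.rev_rev a)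
  t_rev := by
    intro a
    induction a using Quotient.inductionOn with
    | h a => exact congrArg (Quotient.mk E.relV) (Γ.t_rev a)

/-- An equivalence relation on vertices, extended to arcs by declaring two arcs equivalent
if and only if their origins and their termini are equivalent. -/
def Equivalence.ofVertices (Γ : SerreGraph.{u, v}) (R : Setoid Γ.V) : Γ.Equivalence where
  relV := R
  relA :=
    { r := fun a b => R (Γ.o a) (Γ.o b) ∧ R (Γ.t a) (Γ.t b)
      iseqv :=
        { refl := fun _ => ⟨R.refl _, R.refl _⟩
          symm := fun h => ⟨R.symm h.1, R.symm h.2⟩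
          trans := fun h k => ⟨R.trans h.1 k.1, R.trans h.2 k.2⟩ } }
  o_rel := fun _ _ h => h.1
  t_rel := fun _ _ h => h.2
  rev_rel := by
    rintro a b ⟨h, k⟩
    change R (Γ.o (Γ.rev a)) (Γ.o (Γ.rev b)) ∧ R (Γ.t (Γ.rev a)) (Γ.t (Γ.rev b))
    rw [Γ.o_rev, Γ.o_rev, Γ.t_rev, Γ.t_rev]
    exact ⟨k, h⟩

/-- The graph equivalence relation given by the orbits of a group acting by automorphisms. -/
def orbitEquivalence {K : Type w} [Group K] (Γ : SerreGraph.{u, v}) (φ : K →* Γ.Aut) :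
    Γ.Equivalence where
  relV :=
    { r := fun x y => ∃ g : K, (φ g).1.1 x = y
      iseqv :=
        { refl := fun x => ⟨1, by simp⟩
          symm := by
            rintro x y ⟨g, rfl⟩
            exact ⟨g⁻¹, by simp⟩
          trans := by
            rintro x y y' ⟨g, rfl⟩ ⟨h, rfl⟩
            exact ⟨h * g, by simp⟩ } }
  relA :=
    { r := fun a b => ∃ g : K, (φ g).1.2 a = b
      iseqv :=
        { refl := fun x => ⟨1, by simp⟩
          symm := by
            rintro x y ⟨g, rfl⟩
            exact ⟨g⁻¹, by simp⟩
          trans := by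
            rintro x y y' ⟨g, rfl⟩ ⟨h, rfl⟩
            exact ⟨h * g, by simp⟩ } }
  o_rel := by
    rintro a b ⟨g, rfl⟩
    exact ⟨g, ((φ g).2 a).1.symm⟩
  t_rel := by
    rintro a b ⟨g, rfl⟩
    exact ⟨g, ((φ g).2 a).2.1.symm⟩
  rev_rel := by
    rintro a b ⟨g, rfl⟩
    exact ⟨g, ((φ g).2 a).2.2.symm⟩

/-- The quotient graph `Γ / K` of a group `K` acting on `Γ` by automorphisms. -/
def orbitGraph {K : Type w} [Group K] (Γ : SerreGraph.{u, v}) (φ : K →* Γ.Aut) :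
    SerreGraph.{u, v} :=
  Γ.quotient (Γ.orbitEquivalence φ)

end SerreGraph

/-- An embedding of permutation group actions `(H, Y) ↪ (G, X)`: an injection `Φ` that
identifies `H` with the permutation group induced on `Φ(Y)` by its setwise stabiliser in `G`. -/
structure IsActionEmbedding {Y : Type z} {X : Type w} (H : Subgroup (Equiv.Perm Y))
    (G : Subgroup (Equiv.Perm X)) (Φ : Y → X) : Prop where
  injective : Function.Injective Φ
  extend : ∀ h ∈ H, ∃ g ∈ G, ∀ y, g (Φ y) = Φ (h y)
  restrict : ∀ g ∈ G, g '' Set.range Φ = Set.range Φ → ∃ h ∈ H, ∀ y, g (Φ y) = Φ (h y)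

/-- A graph of group actions. A permutation group action is a subgroup of the symmetric group
of a non-empty set. The requirement `(H(rev a), Y(rev a)) = (H(a), Y(a))` is expressed by
indexing the actions at the arcs by the edges of the base graph. -/
structure GraphOfGroupActions where
  /-- the base graph -/
  base : SerreGraph.{u, v}
  connected : base.toMultiDigraph.IsConnected
  X : base.V → Type w
  X_nonempty : ∀ x, Nonempty (X x)
  G : ∀ x, Subgroup (Equiv.Perm (X x))
  Y : base.Edge → Type z
  Y_nonempty : ∀ e, Nonempty (Y e)
  H : ∀ e, Subgroup (Equiv.Perm (Y e))
  Φ : ∀ a : base.A, Y (base.edge a) → X (base.t a)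
  Φ_embedding : ∀ a, IsActionEmbedding (H (base.edge a)) (G (base.t a)) (Φ a)
  /-- the inversion agent of a self-reverse arc -/
  agent : ∀ a, base.rev a = a → Equiv.Perm (Y (base.edge a))
  agent_conj : ∀ a (ha : base.rev a = a) (σ : Equiv.Perm (Y (base.edge a))),
    agent a ha * σ * (agent a ha)⁻¹ ∈ H (base.edge a) ↔ σ ∈ H (base.edge a)
  agent_sq : ∀ a (ha : base.rev a = a), agent a ha ^ 2 ∈ H (base.edge a)

namespace GraphOfGroupActions

/-- An `a`-adhesion map: `Ψ = γ Φ_a` with `γ ∈ G(t(a))`. -/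
def IsAdhesionMap (𝒢 : GraphOfGroupActions.{u, v, w, z}) (a : 𝒢.base.A)
    (Ψ : 𝒢.Y (𝒢.base.edge a) → 𝒢.X (𝒢.base.t a)) : Prop :=
  ∃ γ ∈ 𝒢.G (𝒢.base.t a), ∀ y, Ψ y = γ (𝒢.Φ a y)

/-- A twisted `a`-adhesion map, for a self-reverse arc `a`: `Ψ = γ Φ_a h_a`, `γ ∈ G(t(a))`. -/
def IsTwistedAdhesionMap (𝒢 : GraphOfGroupActions.{u, v, w, z}) (a : 𝒢.base.A)
    (ha : 𝒢.base.rev a = a) (Ψ : 𝒢.Y (𝒢.base.edge a) → 𝒢.X (𝒢.base.t a)) : Prop :=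
  ∃ γ ∈ 𝒢.G (𝒢.base.t a), ∀ y, Ψ y = γ (𝒢.Φ a (𝒢.agent a ha y))

/-- An `a`-adhesion set: a translate of `Φ_a(Y(a))` under `G(t(a))`. -/
def IsAdhesionSet (𝒢 : GraphOfGroupActions.{u, v, w, z}) (a : 𝒢.base.A)
    (B : Set (𝒢.X (𝒢.base.t a))) : Prop :=
  ∃ γ ∈ 𝒢.G (𝒢.base.t a), B = γ '' Set.range (𝒢.Φ a)

/-- The augmented base digraph: every arc `a` of the base graph is replaced by as many parallel
arcs as there are `a`-adhesion sets; these copies are labelled by the `a`-adhesion sets. -/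
def augmented (𝒢 : GraphOfGroupActions.{u, v, w, z}) : MultiDigraph.{u, max v w} where
  V := 𝒢.base.V
  A := Σ a : 𝒢.base.A, {B : Set (𝒢.X (𝒢.base.t a)) // 𝒢.IsAdhesionSet a B}
  o b := 𝒢.base.o b.1
  t b := 𝒢.base.t b.1

end GraphOfGroupActions

/-- A digraph morphism from a tree `T` to a digraph `Γ` is a `Star`-covering map if it is
surjective and restricts to a bijection from the star of `x` to the star of its image, for every
vertex `x`. -/
structure IsStarCoveringMap (T : SerreGraph.{s, r}) (Γ : MultiDigraph.{u, v})
    (f : MultiDigraph.Hom T.toMultiDigraph Γ) : Prop where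
  tree : T.IsTree
  surjV : Function.Surjective f.onV
  surjA : Function.Surjective f.onA
  star : ∀ x, Set.BijOn f.onA (T.toMultiDigraph.star x) (Γ.star (f.onV x))

/-- A scaffolding `(Σ, ∼, π, p)` for a graph of group actions. The legal colouring `p` takes its
values in the disjoint unions of the `X(v)` and of the `Y(e)`. -/
structure Scaffolding (𝒢 : GraphOfGroupActions.{u, v, w, z}) where
  graph : SerreGraph.{s, r}
  rel : Setoid graph.V
  /-- the quotient graph `T_Σ` is a tree -/
  isTree : (graph.quotient (.ofVertices graph rel)).IsTree
  /-- each vertex bundle induces a graph without arcs -/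
  bundle_empty : ∀ c, ¬ rel (graph.o c) (graph.t c)
  π : SerreGraph.Hom (graph.quotient (.ofVertices graph rel)) 𝒢.base
  pV : graph.V → Σ x : 𝒢.base.V, 𝒢.X x
  pA : graph.A → Σ e : 𝒢.base.Edge, 𝒢.Y e
  /-- `p` restricts to a bijection from `[v]` to `X(π(⟦v⟧))` -/
  pV_bijOn : ∀ x : (graph.quotient (.ofVertices graph rel)).V,
    Set.BijOn pV {y | Quotient.mk _ y = x} {c | c.1 = π.onV x}
  /-- `p` restricts to a bijection from `[a]` to `Y(π(⟦a⟧))` -/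
  pA_bijOn : ∀ α : (graph.quotient (.ofVertices graph rel)).A,
    Set.BijOn pA {c | Quotient.mk _ c = α} {d | d.1 = 𝒢.base.edge (π.onA α)}
  pA_rev : ∀ c, pA (graph.rev c) = pA c
  /-- if `π(⟦a⟧)` is not self-reverse, the map `Ψ` with `Ψ p(c) = p(t(c))` for `c ∈ [a]` is an
  adhesion map -/
  adhesion : ∀ α, 𝒢.base.rev (π.onA α) ≠ π.onA α →
    ∃ Ψ, 𝒢.IsAdhesionMap (π.onA α) Ψ ∧
      ∀ c, Quotient.mk _ c = α → ∃ y, pA c = ⟨𝒢.base.edge (π.onA α), y⟩ ∧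
        pV (graph.t c) = ⟨𝒢.base.t (π.onA α), Ψ y⟩
  /-- if `π(⟦a⟧)` is self-reverse, then one of the maps `Ψ` belonging to `⟦a⟧` and to its reverse
  is an adhesion map and the other one is a twisted adhesion map -/
  adhesion_self : ∀ α (b : 𝒢.base.A) (hb : 𝒢.base.rev b = b), π.onA α = b →
    ∃ Ψ Ψ' : 𝒢.Y (𝒢.base.edge b) → 𝒢.X (𝒢.base.t b),
      ((𝒢.IsAdhesionMap b Ψ ∧ 𝒢.IsTwistedAdhesionMap b hb Ψ') ∨
        (𝒢.IsTwistedAdhesionMap b hb Ψ ∧ 𝒢.IsAdhesionMap b Ψ')) ∧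
      (∀ c, Quotient.mk _ c = α → ∃ y, pA c = ⟨𝒢.base.edge b, y⟩ ∧
        pV (graph.t c) = ⟨𝒢.base.t b, Ψ y⟩) ∧
      (∀ c, Quotient.mk _ c = (graph.quotient (.ofVertices graph rel)).rev α →
        ∃ y, pA c = ⟨𝒢.base.edge b, y⟩ ∧ pV (graph.t c) = ⟨𝒢.base.t b, Ψ' y⟩)
  /-- for `t(b) = π(⟦v⟧)` and a `b`-adhesion set `B`, exactly one arc `⟦a⟧` of `T_Σ` with terminus
  `⟦v⟧` and `π(⟦a⟧) = b` satisfies `Ψ p([a]) = p(t([a])) = B` -/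
  adhesion_unique : ∀ (x : (graph.quotient (.ofVertices graph rel)).V) (b : 𝒢.base.A),
    𝒢.base.t b = π.onV x → ∀ B : Set (𝒢.X (𝒢.base.t b)), 𝒢.IsAdhesionSet b B →
      ∃! α : (graph.quotient (.ofVertices graph rel)).A, π.onA α = b ∧
        (graph.quotient (.ofVertices graph rel)).t α = x ∧
        (fun c => pV (graph.t c)) '' {c | Quotient.mk _ c = α} = Sigma.mk (𝒢.base.t b) '' B

namespace Scaffolding

variable {𝒢 : GraphOfGroupActions.{u, v, w, z}}

/-- The tree `T_Σ`, the quotient of the scaffolding by `∼`. -/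
abbrev tree (S : Scaffolding.{u, v, w, z, s, r} 𝒢) : SerreGraph.{s, r} :=
  S.graph.quotient (.ofVertices S.graph S.rel)

/-- The vertex `⟦y⟧` of `T_Σ`. -/
def mkV (S : Scaffolding.{u, v, w, z, s, r} 𝒢) (y : S.graph.V) : S.tree.V := Quotient.mk _ y

/-- The arc `⟦c⟧` of `T_Σ`. -/
def mkA (S : Scaffolding.{u, v, w, z, s, r} 𝒢) (c : S.graph.A) : S.tree.A := Quotient.mk _ c

/-- The group of scaffolding automorphisms: automorphisms of `Σ` that preserve `∼` and `π`. -/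
def autSc (S : Scaffolding.{u, v, w, z, s, r} 𝒢) : Subgroup S.graph.Aut where
  carrier := {g | (∀ x y, S.rel (g.1.1 x) (g.1.1 y) ↔ S.rel x y) ∧
    (∀ x, S.π.onV (S.mkV (g.1.1 x)) = S.π.onV (S.mkV x)) ∧
    (∀ c, S.π.onA (S.mkA (g.1.2 c)) = S.π.onA (S.mkA c))}
  one_mem' := ⟨fun _ _ => Iff.rfl, fun _ => rfl, fun _ => rfl⟩
  mul_mem' := by
    rintro g h ⟨g1, g2, g3⟩ ⟨h1, h2, h3⟩
    exact ⟨fun x y => (g1 _ _).trans (h1 x y), fun x => (g2 _).trans (h2 x),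
      fun c => (g3 _).trans (h3 c)⟩
  inv_mem' := by
    rintro g ⟨g1, g2, g3⟩
    refine ⟨fun x y => ?_, fun x => ?_, fun c => ?_⟩
    · simpa using (g1 (g.1.1⁻¹ x) (g.1.1⁻¹ y)).symm
    · simpa using (g2 (g.1.1⁻¹ x)).symm
    · simpa using (g3 (g.1.2⁻¹ c)).symm

/-- `γ` is the local action at the vertex bundle `x` of the automorphism `g`:
`p(g(y)) = γ(p(y))` for all `y` in the bundle. -/
def IsLocalAction (S : Scaffolding.{u, v, w, z, s, r} 𝒢) (g : S.graph.Aut) (x : S.tree.V)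
    (γ : Equiv.Perm (𝒢.X (S.π.onV x))) : Prop :=
  ∀ y, S.mkV y = x → ∃ c, S.pV y = ⟨S.π.onV x, c⟩ ∧ S.pV (g.1.1 y) = ⟨S.π.onV x, γ c⟩

/-- The universal group: the scaffolding automorphisms whose local action at every vertex bundle
`⟦v⟧` belongs to `G(π(⟦v⟧))`. -/
def universalGroup (S : Scaffolding.{u, v, w, z, s, r} 𝒢) : Subgroup S.graph.Aut where
  carrier := {g | g ∈ S.autSc ∧ ∀ x : S.tree.V, ∃ γ ∈ 𝒢.G (S.π.onV x), S.IsLocalAction g x γ}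
  one_mem' := by
    refine ⟨S.autSc.one_mem, fun x => ⟨1, Subgroup.one_mem _, fun y hy => ?_⟩⟩
    have h : (S.pV y).1 = S.π.onV x := (S.pV_bijOn x).mapsTo hy
    change ∃ c, S.pV y = ⟨S.π.onV x, c⟩ ∧ S.pV y = ⟨S.π.onV x, c⟩
    generalize S.pV y = q at h
    obtain ⟨k, c⟩ := q
    dsimp only at h
    subst h
    exact ⟨c, rfl, rfl⟩
  mul_mem' := by
    rintro g h ⟨hg, hg'⟩ ⟨hh, hh'⟩
    refine ⟨S.autSc.mul_mem hg hh, fun x => ?_⟩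
    obtain ⟨y₀, rfl⟩ : ∃ y₀, S.mkV y₀ = x := Quotient.exists_rep x
    obtain ⟨γ, hγ, hγ'⟩ := hh' (S.mkV y₀)
    have key : ∃ δ ∈ 𝒢.G (S.π.onV (S.mkV y₀)), ∀ y, S.mkV y = S.mkV (h.1.1 y₀) →
        ∃ c, S.pV y = ⟨S.π.onV (S.mkV y₀), c⟩ ∧
          S.pV (g.1.1 y) = ⟨S.π.onV (S.mkV y₀), δ c⟩ := by
      obtain ⟨δ, hδ, hδ'⟩ := hg' (S.mkV (h.1.1 y₀))
      unfold IsLocalAction at hδ'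
      revert δ
      rw [hh.2.1 y₀]
      intro δ hδ hδ'
      exact ⟨δ, hδ, hδ'⟩
    obtain ⟨δ, hδ, hδ'⟩ := key
    refine ⟨δ * γ, Subgroup.mul_mem _ hδ hγ, fun y hy => ?_⟩
    obtain ⟨c, hc, hc'⟩ := hγ' y hy
    obtain ⟨d, hd, hd'⟩ := hδ' (h.1.1 y) (Quotient.sound ((hh.1 _ _).2 (Quotient.exact hy)))
    obtain rfl : γ c = d := by
      rw [hc'] at hd
      simpa using hd
    exact ⟨c, hc, hd'⟩
  inv_mem' := by
    rintro g ⟨hg, hg'⟩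
    refine ⟨S.autSc.inv_mem hg, fun x => ?_⟩
    obtain ⟨y₀, rfl⟩ : ∃ y₀, S.mkV y₀ = x := Quotient.exists_rep x
    have e : S.π.onV (S.mkV (g.1.1⁻¹ y₀)) = S.π.onV (S.mkV y₀) :=
      (S.autSc.inv_mem hg).2.1 y₀
    have key : ∃ δ ∈ 𝒢.G (S.π.onV (S.mkV y₀)), ∀ y, S.mkV y = S.mkV (g.1.1⁻¹ y₀) →
        ∃ c, S.pV y = ⟨S.π.onV (S.mkV y₀), c⟩ ∧
          S.pV (g.1.1 y) = ⟨S.π.onV (S.mkV y₀), δ c⟩ := by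
      obtain ⟨δ, hδ, hδ'⟩ := hg' (S.mkV (g.1.1⁻¹ y₀))
      unfold IsLocalAction at hδ'
      revert δ
      rw [e]
      intro δ hδ hδ'
      exact ⟨δ, hδ, hδ'⟩
    obtain ⟨δ, hδ, hδ'⟩ := key
    refine ⟨δ⁻¹, Subgroup.inv_mem _ hδ, fun y hy => ?_⟩
    obtain ⟨c, hc, hc'⟩ := hδ' (g.1.1⁻¹ y)
      (Quotient.sound (((S.autSc.inv_mem hg).1 _ _).2 (Quotient.exact hy)))
    refine ⟨δ c, by simpa using hc', ?_⟩
    simpa using hc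

/-- The action of the universal group on the tree `T_Σ`. -/
def treeAction (S : Scaffolding.{u, v, w, z, s, r} 𝒢) : S.universalGroup →* S.tree.Aut where
  toFun g :=
    ⟨(Quotient.congr g.1.1.1 (fun x y => (g.2.1.1 x y).symm),
      Quotient.congr g.1.1.2 (fun a b => by
        obtain ⟨ha, ha', -⟩ := g.1.2 a
        obtain ⟨hb, hb', -⟩ := g.1.2 b
        change S.rel _ _ ∧ S.rel _ _ ↔ S.rel _ _ ∧ S.rel _ _
        rw [ha, ha', hb, hb', g.2.1.1, g.2.1.1])), by
      intro α
      induction α using Quotient.inductionOn with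
      | h c =>
        exact ⟨congrArg (Quotient.mk _) (g.1.2 c).1, congrArg (Quotient.mk _) (g.1.2 c).2.1,
          congrArg (Quotient.mk _) (g.1.2 c).2.2⟩⟩
  map_one' := by
    refine Subtype.ext (Prod.ext (Equiv.ext fun x => ?_) (Equiv.ext fun x => ?_)) <;>
      induction x using Quotient.inductionOn <;> rfl
  map_mul' g h := by
    refine Subtype.ext (Prod.ext (Equiv.ext fun x => ?_) (Equiv.ext fun x => ?_)) <;>
      induction x using Quotient.inductionOn <;> rfl

end Scaffolding

/-! The heart is an extension property, `exists_mem_universalGroup`: if two vertices of the tree lie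
over the same base vertex, any prescribed local action is realised there by an element of the
universal group carrying the first vertex to the second. By condition 5 an arc of the tree is
determined by its terminus, its base arc and its adhesion set, so a local action at a vertex
dictates where each arc ending there must go. Along such an arc the prescribed action changes one
parametrisation of an adhesion set into another by an element of `H`, up to inversion agents.
Because the agents normalise `H` and have squares in `H`, the induced change at the other end is
again in `H`, and it extends to an element of the local group at the origin (`IsTwist.mem`,
`IsLegalPair.transfer`).

In a tree these choices can be propagated from one vertex without conflict
(`IsTree.exists_section`). The resulting self-map is locally injective, hence injective since there
are no cycles; it lifts arcs at every vertex, hence is surjective by connectedness. The colourings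
lift it to an automorphism of the scaffolding. This yields the vertex orbits; for arcs over the same
base arc, one prescribes a local action carrying one adhesion set to the other. Surjectivity of `π`
comes from lifting arcs over the connected base, and the covering map records the base arc and the
adhesion set of each arc.

For existence, the tree is coded by reduced words of labels (base arc, adhesion set), read as paths
to a root. A word acquires one new neighbour for each admissible label, except the label already
used by the arc coming from the root's side. That exception gives both uniqueness of the arcs in a
star and the absence of cycles. Each edge is coloured by an adhesion map towards the root and the
standard embedding away from it, twisted by the agent when the base arc is self-reverse. -/

namespace SimpleGraph

/-! ### Propagation, injectivity and recognition of trees. -/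

variable {V : Type*} {W : Type*}

/-- A symmetric, totally extendable relation between states at adjacent vertices of a tree has a
global section with a prescribed value. -/
theorem IsTree.exists_section {T : SimpleGraph V} (hT : T.IsTree) {St : Type*}
    (P : V → St → Prop) (R : V → V → St → St → Prop)
    (symm : ∀ x z a b, R x z a b → R z x b a)
    (extend : ∀ x z a, T.Adj x z → P x a → ∃ b, P z b ∧ R x z a b)
    (x₀ : V) (a₀ : St) (h₀ : P x₀ a₀) :
    ∃ σ : V → St, σ x₀ = a₀ ∧ (∀ x, P x (σ x)) ∧ ∀ x z, T.Adj x z → R x z (σ x) (σ z) := by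
  classical
  -- The junk value `a` makes the choice total, so transport can be defined along any walk without
  -- carrying proofs.
  have ext : ∀ x z a, ∃ b, T.Adj x z → P x a → P z b ∧ R x z a b := by
    intro x z a
    by_cases h : T.Adj x z ∧ P x a
    · obtain ⟨b, hb⟩ := extend x z a h.1 h.2
      exact ⟨b, fun _ _ => hb⟩
    · exact ⟨a, fun h1 h2 => (h ⟨h1, h2⟩).elim⟩
  choose e he using ext
  let F : ∀ {x z : V}, T.Walk x z → St → St := fun p =>
    Walk.rec (motive := fun _ _ _ => St → St) (fun a => a)
      (fun {x y _} _ _ ih a => ih (e x y a)) p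
  have F_concat : ∀ {x y z : V} (p : T.Walk x y) (h : T.Adj y z) (a : St),
      F (p.concat h) a = e y z (F p a) := by
    intro x y z p h
    induction p with
    | nil => intro a; rfl
    | cons h' q ih => intro a; exact ih h _
  have F_P : ∀ {x z : V} (p : T.Walk x z) (a : St), P x a → P z (F p a) := by
    intro x z p
    induction p with
    | nil => intro a ha; exact ha
    | cons h' q ih => intro a ha; exact ih _ (he _ _ _ h' ha).1
  choose p hp hp' using hT.existsUnique_path x₀
  have key : ∀ x z (h : T.Adj x z), p z = (p x).concat h →
      R x z (F (p x) a₀) (F (p z) a₀) := by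
    intro x z h hz
    rw [hz, F_concat]
    exact (he _ _ _ h (F_P _ _ h₀)).2
  refine ⟨fun x => F (p x) a₀, ?_, fun x => F_P _ _ h₀, fun x z h => ?_⟩
  · have : p x₀ = Walk.nil := (hp' x₀ Walk.nil Walk.IsPath.nil).symm
    simp only [this]
    rfl
  -- Of two adjacent vertices in a tree, one lies on the path from `x₀` to the other. That path
  -- therefore ends with the edge in question; symmetry of `R` covers both directions.
  · by_cases hx : x ∈ (p z).support
    · exact key x z h (hT.isAcyclic.path_concat (hp x) (hp z) h hx)
    · refine symm _ _ _ _ (key z x h.symm ?_)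
      exact hT.isAcyclic.path_concat (hp z) (hp x) h.symm
        (hT.isAcyclic.mem_support_of_ne_mem_support_of_adj_of_isPath (hp x) (hp z) h hx)

/-- A locally injective homomorphism from a connected graph to a forest is injective. -/
theorem IsAcyclic.injective_of_locally_injective {G : SimpleGraph V} {G' : SimpleGraph W}
    (hG : G.Connected) (hG' : G'.IsAcyclic) (f : G →g G')
    (hf : ∀ x y z, G.Adj y x → G.Adj y z → f x = f z → x = z) : Function.Injective f := by
  have chain : ∀ {x z : V} (p : G.Walk x z), p.IsPath →
      List.IsChain (· ≠ ·) (p.map f).edges := by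
    intro x z p
    induction p with
    | nil => intro _; simp
    | @cons u v w h q ih =>
      intro hp
      rw [Walk.cons_isPath_iff] at hp
      have ihq := ih hp.1
      cases q with
      | nil => simp
      | @cons _ v' _ h' q' =>
        rw [Walk.map_cons, Walk.edges_cons]
        rw [Walk.map_cons, Walk.edges_cons] at ihq ⊢
        refine List.isChain_cons_cons.2 ⟨fun heq => ?_, ihq⟩
        rcases Sym2.eq_iff.1 heq with ⟨h1, -⟩ | ⟨h1, -⟩
        · exact (f.map_adj h).ne h1
        · refine hp.2 ?_
          rw [hf u v v' h.symm h' h1]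
          simp
  intro x z hxz
  obtain ⟨p, hp⟩ := hG.exists_isPath x z
  -- Local injectivity prevents the image of a path from backtracking, and in a forest a walk
  -- without backtracking is a path. If its ends agree, it has length zero.
  have hpath := (hG'.isPath_iff_isChain (p.map f)).2 (chain p hp)
  cases p with
  | nil => rfl
  | cons h q =>
    exfalso
    rw [Walk.map_cons, Walk.cons_isPath_iff] at hpath
    exact hpath.2 (hxz.substr (p := fun a => a ∈ (q.map f).support) (Walk.end_mem_support _))

/-- A map into a connected graph along which neighbours lift is surjective. -/
theorem Connected.surjective_of_lift {G' : SimpleGraph W} [Nonempty V] (hG' : G'.Connected)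
    (f : V → W) (hf : ∀ x w, G'.Adj (f x) w → ∃ z, f z = w) : Function.Surjective f := by
  obtain ⟨x₀⟩ := ‹Nonempty V›
  intro w
  obtain ⟨p⟩ := hG'.preconnected (f x₀) w
  suffices h : ∀ {a b : W}, G'.Walk a b → (∃ x, f x = a) → ∃ x, f x = b from h p ⟨x₀, rfl⟩
  intro a b p
  induction p with
  | nil => exact id
  | cons h q ih =>
    rintro ⟨x, rfl⟩
    exact ih (hf x _ h)

/-- A graph whose vertices are injectively coded by lists, such that the tail of the code of a
vertex is the code of a neighbour and all adjacencies are of this form, is a tree. -/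
theorem isTree_of_list_code {G : SimpleGraph V} {L : Type*} (code : V → List L)
    (inj : Function.Injective code) (root : ∃ x, code x = [])
    (adj : ∀ x y, G.Adj x y → (∃ l, code x = l :: code y) ∨ ∃ l, code y = l :: code x)
    (parent : ∀ x l w, code x = l :: w → ∃ y, G.Adj x y ∧ code y = w) : G.IsTree := by
  obtain ⟨x₀, h₀⟩ := root
  have reach : ∀ w x, code x = w → G.Reachable x x₀ := by
    intro w
    induction w with
    | nil => intro x hx; rw [inj (hx.trans h₀.symm)]
    | cons l w ih =>
      intro x hx
      obtain ⟨y, hxy, hy⟩ := parent x l w hx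
      exact hxy.reachable.trans (ih y hy)
  have bridge : ∀ x y l, code x = l :: code y → G.IsBridge s(x, y) := by
    intro x y l hxy
    rw [isBridge_iff]
    rintro ⟨p⟩
    -- The vertices whose codes end in `code x` form the branch at `x`. The only edge leaving it is
    -- the deleted one, and the shorter code of `y` lies outside it.
    suffices h : ∀ {a b : V}, (G.deleteEdges {s(x, y)}).Walk a b → code x <:+ code a →
        code x <:+ code b by
      have := (h p List.suffix_rfl).length_le
      rw [hxy] at this
      simp at this
    intro a b p
    induction p with
    | nil => exact id
    | @cons u v _ h q ih =>
      intro hu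
      refine ih ?_
      rw [deleteEdges_adj] at h
      rcases adj u v h.1 with ⟨m, hm⟩ | ⟨m, hm⟩
      · rw [hm, List.suffix_cons_iff] at hu
        rcases hu with hu | hu
        · rw [← hm] at hu
          obtain rfl := inj hu
          rw [hxy] at hm
          obtain rfl := inj (List.cons.inj hm).2
          simp at h
        · exact hu
      · rw [hm]
        exact hu.trans (List.suffix_cons _ _)
  have : Nonempty V := ⟨x₀⟩
  refine (isTree_iff _).2 ⟨Connected.mk fun x y => (reach _ x rfl).trans (reach _ y rfl).symm, ?_⟩
  rw [isAcyclic_iff_forall_adj_isBridge]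
  intro x y hxy
  rcases adj x y hxy with ⟨l, h⟩ | ⟨l, h⟩
  · exact bridge x y l h
  · rw [Sym2.eq_swap]
    exact bridge y x l h

end SimpleGraph

/-! ### The product of the local groups, twists and transfer across an edge. -/

theorem SerreGraph.edge_rev (Γ : SerreGraph.{u, v}) (a : Γ.A) : Γ.edge (Γ.rev a) = Γ.edge a :=
  Quotient.sound (Or.inr rfl)

namespace GraphOfGroupActions

variable (𝒢 : GraphOfGroupActions.{u, v, w, z})

/-- The action of the product of the groups `G(v)` on the disjoint union of the sets `X(v)`. -/
def move : (∀ k, 𝒢.G k) →* Equiv.Perm (Σ k, 𝒢.X k) where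
  toFun γ := Equiv.sigmaCongrRight fun k => (γ k).1
  map_one' := rfl
  map_mul' _ _ := rfl

theorem move_mk (γ : ∀ k, 𝒢.G k) (k : 𝒢.base.V) (c : 𝒢.X k) :
    𝒢.move γ ⟨k, c⟩ = ⟨k, (γ k).1 c⟩ := rfl

theorem move_fst (γ : ∀ k, 𝒢.G k) (q : Σ k, 𝒢.X k) : (𝒢.move γ q).1 = q.1 := rfl

theorem move_mul_apply (γ δ : ∀ k, 𝒢.G k) (q : Σ k, 𝒢.X k) :
    𝒢.move (γ * δ) q = 𝒢.move γ (𝒢.move δ q) := rfl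

theorem move_inv_move (γ : ∀ k, 𝒢.G k) (q : Σ k, 𝒢.X k) : 𝒢.move γ⁻¹ (𝒢.move γ q) = q := by
  rw [← move_mul_apply, inv_mul_cancel, map_one, Equiv.Perm.one_apply]

theorem move_move_inv (γ : ∀ k, 𝒢.G k) (q : Σ k, 𝒢.X k) : 𝒢.move γ (𝒢.move γ⁻¹ q) = q := by
  rw [← move_mul_apply, mul_inv_cancel, map_one, Equiv.Perm.one_apply]

/-- The element is completed by the identity at all other base vertices. Working in the whole
product lets different vertices of the tree share local data without transport along equalities of
base vertices. -/
theorem exists_move {k : 𝒢.base.V} {g : Equiv.Perm (𝒢.X k)} (hg : g ∈ 𝒢.G k) :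
    ∃ γ, ∀ c, 𝒢.move γ ⟨k, c⟩ = ⟨k, g c⟩ := by
  classical
  refine ⟨Pi.mulSingle k ⟨g, hg⟩, fun c => ?_⟩
  rw [move_mk, Pi.mulSingle_eq_same]

variable {𝒢} in
/-- `Φ` is an embedding of `(H(e), Y(e))`, relative to the product of the groups `G(v)` acting on
the disjoint union of the sets `X(v)`. -/
structure IsProductEmbedding {e : 𝒢.base.Edge} (Φ : 𝒢.Y e → Σ k, 𝒢.X k) : Prop where
  injective : Function.Injective Φ
  extend : ∀ h ∈ 𝒢.H e, ∃ γ, ∀ y, 𝒢.move γ (Φ y) = Φ (h y)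
  restrict : ∀ γ, 𝒢.move γ '' Set.range Φ = Set.range Φ →
    ∃ h ∈ 𝒢.H e, ∀ y, 𝒢.move γ (Φ y) = Φ (h y)

/-- The embedding at an arc, as a map into the disjoint union of the sets `X(v)`. -/
def emb (b : 𝒢.base.A) (y : 𝒢.Y (𝒢.base.edge b)) : Σ k, 𝒢.X k := ⟨𝒢.base.t b, 𝒢.Φ b y⟩

/-- The embedding at the reverse of an arc. -/
def embRev (b : 𝒢.base.A) (y : 𝒢.Y (𝒢.base.edge b)) : Σ k, 𝒢.X k :=
  𝒢.emb (𝒢.base.rev b) (cast (congrArg 𝒢.Y (𝒢.base.edge_rev b).symm) y)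

/-- Comparing arc colours in the disjoint union of the `Y(e)` absorbs the cast between the equal
edges of `b` and its reverse. -/
theorem embRev_eq {b b' : 𝒢.base.A} (h : b' = 𝒢.base.rev b) (y : 𝒢.Y (𝒢.base.edge b))
    (y' : 𝒢.Y (𝒢.base.edge b'))
    (hy : (⟨𝒢.base.edge b, y⟩ : Σ e, 𝒢.Y e) = ⟨𝒢.base.edge b', y'⟩) :
    𝒢.embRev b y = 𝒢.emb b' y' := by
  subst h
  rw [embRev, eq_of_heq ((cast_heq _ y).trans (Sigma.mk.inj hy).2)]

theorem embRev_of_self {b : 𝒢.base.A} (h : 𝒢.base.rev b = b) (y : 𝒢.Y (𝒢.base.edge b)) :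
    𝒢.embRev b y = 𝒢.emb b y :=
  𝒢.embRev_eq h.symm y y rfl

theorem range_embRev (b : 𝒢.base.A) :
    Set.range (𝒢.embRev b) = Set.range (𝒢.emb (𝒢.base.rev b)) :=
  (Equiv.cast (congrArg 𝒢.Y (𝒢.base.edge_rev b).symm)).surjective.range_comp
    (𝒢.emb (𝒢.base.rev b))

theorem range_move_emb_perm (b : 𝒢.base.A) (γ : ∀ k, 𝒢.G k)
    (k : Equiv.Perm (𝒢.Y (𝒢.base.edge b))) :
    Set.range (fun y => 𝒢.move γ (𝒢.emb b (k y))) = 𝒢.move γ '' Set.range (𝒢.emb b) := by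
  rw [← Set.range_comp]
  exact k.surjective.range_comp (𝒢.move γ ∘ 𝒢.emb b)

theorem isProductEmbedding_emb (b : 𝒢.base.A) : IsProductEmbedding (𝒢.emb b) where
  injective := sigma_mk_injective.comp (𝒢.Φ_embedding b).injective
  extend h hh := by
    obtain ⟨g, hg, h'⟩ := (𝒢.Φ_embedding b).extend h hh
    obtain ⟨γ, hγ⟩ := 𝒢.exists_move hg
    exact ⟨γ, fun y => (hγ _).trans (congrArg (Sigma.mk _) (h' y))⟩
  restrict γ hγ := by
    obtain ⟨h, hh, h'⟩ := (𝒢.Φ_embedding b).restrict (γ (𝒢.base.t b)).1 (γ (𝒢.base.t b)).2 (by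
      refine Set.image_injective.2 (sigma_mk_injective (i := 𝒢.base.t b)) ?_
      simp only [← Set.range_comp] at hγ ⊢
      exact hγ)
    exact ⟨h, hh, fun y => congrArg (Sigma.mk _) (h' y)⟩

theorem isProductEmbedding_embRev (b : 𝒢.base.A) : IsProductEmbedding (𝒢.embRev b) := by
  -- With `e` arbitrary, the cast disappears by substitution.
  have key : ∀ (e : 𝒢.base.Edge) (h : e = 𝒢.base.edge (𝒢.base.rev b)),
      IsProductEmbedding (fun y : 𝒢.Y e => 𝒢.emb (𝒢.base.rev b) (cast (congrArg 𝒢.Y h) y)) := by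
    rintro e rfl
    exact 𝒢.isProductEmbedding_emb _
  exact key _ (𝒢.base.edge_rev b).symm

/-- The pairs of permutations by which the colourings at the two ends of an edge of a scaffolding
may be twisted. -/
def IsTwist (b : 𝒢.base.A) (k k' : Equiv.Perm (𝒢.Y (𝒢.base.edge b))) : Prop :=
  (𝒢.base.rev b ≠ b ∧ k = 1 ∧ k' = 1) ∨
    ∃ hb : 𝒢.base.rev b = b, (k = 1 ∧ k' = 𝒢.agent b hb) ∨ (k = 𝒢.agent b hb ∧ k' = 1)

/-- This is where the conditions on the agent `h` enter. Depending on which ends are twisted, the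
product is a conjugate of `θ` by `h` or `h⁻¹`, or such a conjugate times `h²` or `h⁻²`. -/
theorem IsTwist.mem {𝒢 : GraphOfGroupActions.{u, v, w, z}} {b : 𝒢.base.A}
    {k₁ k₁' k₂ k₂' θ : Equiv.Perm (𝒢.Y (𝒢.base.edge b))}
    (h₁ : 𝒢.IsTwist b k₁ k₁') (h₂ : 𝒢.IsTwist b k₂ k₂') (hθ : θ ∈ 𝒢.H (𝒢.base.edge b)) :
    k₂' * k₂⁻¹ * θ * k₁ * k₁'⁻¹ ∈ 𝒢.H (𝒢.base.edge b) := by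
  rcases h₁ with ⟨hb, rfl, rfl⟩ | ⟨hb, h₁⟩ <;> rcases h₂ with ⟨hb', rfl, rfl⟩ | ⟨hb', h₂⟩
  · simpa using hθ
  · exact absurd hb' hb
  · exact absurd hb hb'
  have conj := 𝒢.agent_conj b hb
  have sq := 𝒢.agent_sq b hb
  generalize 𝒢.agent b hb = h at *
  have conj' : ∀ σ ∈ 𝒢.H (𝒢.base.edge b), h⁻¹ * σ * h ∈ 𝒢.H (𝒢.base.edge b) := fun σ hσ =>
    (conj _).1 (by simpa [mul_assoc] using hσ)
  rcases h₁ with ⟨rfl, rfl⟩ | ⟨rfl, rfl⟩ <;> rcases h₂ with ⟨rfl, rfl⟩ | ⟨rfl, rfl⟩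
  · simpa using (conj θ).2 hθ
  · have := mul_mem (conj' θ hθ) (inv_mem sq)
    simpa [mul_assoc, pow_two] using this
  · have := mul_mem ((conj θ).2 hθ) sq
    simpa [mul_assoc, pow_two] using this
  · simpa using conj' θ hθ

/-- The maps from `Y` to the colours of the termini and of the origins of the arcs of an arc bundle
of a scaffolding that lies over `b`. -/
def IsLegalPair (b : 𝒢.base.A) (F F' : 𝒢.Y (𝒢.base.edge b) → Σ k, 𝒢.X k) : Prop :=
  ∃ γ γ' k k', 𝒢.IsTwist b k k' ∧ (∀ y, F y = 𝒢.move γ (𝒢.emb b (k y))) ∧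
    ∀ y, F' y = 𝒢.move γ' (𝒢.embRev b (k' y))

variable {𝒢}

namespace IsLegalPair

variable {b : 𝒢.base.A} {F F' D D' : 𝒢.Y (𝒢.base.edge b) → Σ k, 𝒢.X k}

theorem injective (h : 𝒢.IsLegalPair b F F') : Function.Injective F := by
  obtain ⟨γ, γ', k, k', -, hF, -⟩ := h
  rw [funext hF]
  exact (𝒢.move γ).injective.comp ((𝒢.isProductEmbedding_emb b).injective.comp k.injective)

theorem range_eq (h : 𝒢.IsLegalPair b F F') :
    ∃ γ, Set.range F = 𝒢.move γ '' Set.range (𝒢.emb b) := by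
  obtain ⟨γ, γ', k, k', -, hF, -⟩ := h
  exact ⟨γ, by rw [funext hF, range_move_emb_perm]⟩

/-- A compatible group element at the terminus of an arc can be continued to the origin. -/
theorem transfer (hF : 𝒢.IsLegalPair b F F') (hD : 𝒢.IsLegalPair b D D') (γ : ∀ k, 𝒢.G k)
    (hγ : Set.range D = 𝒢.move γ '' Set.range F) :
    ∃ δ, ∀ y y', D y' = 𝒢.move γ (F y) → D' y' = 𝒢.move δ (F' y) := by
  obtain ⟨γ₁, γ₁', k₁, k₁', h₁, hF, hF'⟩ := hF
  obtain ⟨γ₂, γ₂', k₂, k₂', h₂, hD, hD'⟩ := hD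
  have hrF : Set.range F = 𝒢.move γ₁ '' Set.range (𝒢.emb b) := by
    rw [funext hF, range_move_emb_perm]
  have hrD : Set.range D = 𝒢.move γ₂ '' Set.range (𝒢.emb b) := by
    rw [funext hD, range_move_emb_perm]
  -- In the standard coordinates of the two charts, `γ` stabilises the image of the embedding, so it
  -- induces an element `θ` of `H`.
  obtain ⟨θ, hθ, hθ'⟩ := (𝒢.isProductEmbedding_emb b).restrict (γ₂⁻¹ * γ * γ₁) (by
    rw [hrF, hrD] at hγ
    rw [map_mul, map_mul, map_inv, Equiv.Perm.coe_mul, Equiv.Perm.coe_mul, Set.image_comp,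
      Set.image_comp, ← hγ, ← Set.image_comp, ← Equiv.Perm.coe_mul, inv_mul_cancel,
      Equiv.Perm.coe_one, Set.image_id])
  -- The same change of arc colours, seen from the origin with its own twists, is again in `H` and
  -- extends through the reverse embedding.
  obtain ⟨ε, hε⟩ := (𝒢.isProductEmbedding_embRev b).extend _ (h₁.mem h₂ hθ)
  refine ⟨γ₂' * ε * γ₁'⁻¹, fun y y' hy => ?_⟩
  have e₁ : k₂ y' = θ (k₁ y) := by
    refine (𝒢.isProductEmbedding_emb b).injective ?_
    rw [← hθ', move_mul_apply, move_mul_apply, ← hF, ← hy, hD, move_inv_move]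
  have e₂ : k₂' y' = (k₂' * k₂⁻¹ * θ * k₁ * k₁'⁻¹) (k₁' y) := by
    simp [← e₁]
  rw [hF', hD', move_mul_apply, move_mul_apply, move_inv_move, hε, e₂]

end IsLegalPair

end GraphOfGroupActions

/-! ### Charts and stars of a scaffolding, and the covering map. -/

namespace SerreGraph

variable (Γ : SerreGraph.{u, v})

theorem underlying_adj_of_ne (a : Γ.A) (h : Γ.o a ≠ Γ.t a) :
    Γ.toMultiDigraph.underlying.Adj (Γ.t a) (Γ.o a) :=
  ⟨h.symm, a, Or.inr ⟨rfl, rfl⟩⟩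

theorem exists_arc_of_underlying_adj {x y : Γ.V} (h : Γ.toMultiDigraph.underlying.Adj x y) :
    ∃ a, Γ.t a = x ∧ Γ.o a = y := by
  obtain ⟨-, a, ⟨h1, h2⟩ | ⟨h1, h2⟩⟩ := h
  · exact ⟨Γ.rev a, (Γ.t_rev a).trans h1, (Γ.o_rev a).trans h2⟩
  · exact ⟨a, h2, h1⟩

end SerreGraph

namespace Scaffolding

open GraphOfGroupActions

variable {𝒢 : GraphOfGroupActions.{u, v, w, z}} (S : Scaffolding.{u, v, w, z, s, r} 𝒢)

theorem mkV_eq_iff {x y : S.graph.V} : S.mkV x = S.mkV y ↔ S.rel x y := Quotient.eq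

theorem mkA_eq_iff {c d : S.graph.A} : S.mkA c = S.mkA d ↔
    S.mkV (S.graph.o c) = S.mkV (S.graph.o d) ∧ S.mkV (S.graph.t c) = S.mkV (S.graph.t d) := by
  rw [mkV_eq_iff, mkV_eq_iff]
  exact Quotient.eq

theorem mkV_surjective : Function.Surjective S.mkV := Quotient.mk_surjective

theorem mkA_surjective : Function.Surjective S.mkA := Quotient.mk_surjective

theorem mkV_t (c : S.graph.A) : S.mkV (S.graph.t c) = S.tree.t (S.mkA c) := rfl

theorem mkV_o (c : S.graph.A) : S.mkV (S.graph.o c) = S.tree.o (S.mkA c) := rfl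

theorem mkA_rev (c : S.graph.A) : S.mkA (S.graph.rev c) = S.tree.rev (S.mkA c) := rfl

theorem tree_arc_ext {α β : S.tree.A} (ho : S.tree.o α = S.tree.o β)
    (ht : S.tree.t α = S.tree.t β) : α = β :=
  S.isTree.1.2 (Prod.ext ho ht)

theorem pV_fst (y : S.graph.V) : (S.pV y).1 = S.π.onV (S.mkV y) := (S.pV_bijOn (S.mkV y)).mapsTo rfl

theorem vertex_ext {x y : S.graph.V} (h : S.mkV x = S.mkV y) (hp : S.pV x = S.pV y) : x = y :=
  (S.pV_bijOn (S.mkV y)).injOn h rfl hp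

theorem exists_vertex (x : S.tree.V) (q : Σ k, 𝒢.X k) (hq : q.1 = S.π.onV x) :
    ∃ y, S.mkV y = x ∧ S.pV y = q :=
  (S.pV_bijOn x).surjOn hq

/-- Condition 4 for an arc and its reverse, merged into one parametrisation by arc colours that
treats self-reverse base arcs and all others alike. Keeping `b` separate from `S.π.onA α` allows two
arcs over the same base arc to be compared over one index type. -/
theorem exists_chart (α : S.tree.A) (b : 𝒢.base.A) (hb : S.π.onA α = b) :
    ∃ F F', 𝒢.IsLegalPair b F F' ∧
      (∀ c, S.mkA c = α → ∃ y, S.pA c = ⟨𝒢.base.edge b, y⟩ ∧ S.pV (S.graph.t c) = F y ∧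
        S.pV (S.graph.o c) = F' y) ∧
      ∀ y, ∃ c, S.mkA c = α ∧ S.pV (S.graph.t c) = F y ∧ S.pV (S.graph.o c) = F' y := by
  suffices h : ∃ F F', 𝒢.IsLegalPair b F F' ∧ ∀ c, S.mkA c = α →
      ∃ y, S.pA c = ⟨𝒢.base.edge b, y⟩ ∧ S.pV (S.graph.t c) = F y ∧
        S.pV (S.graph.o c) = F' y by
    obtain ⟨F, F', h1, h2⟩ := h
    refine ⟨F, F', h1, h2, fun y => ?_⟩
    obtain ⟨c, hc, hc'⟩ := (S.pA_bijOn α).surjOn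
      (show (⟨𝒢.base.edge b, y⟩ : Σ e, 𝒢.Y e) ∈ {d : Σ e, 𝒢.Y e |
        d.1 = 𝒢.base.edge (S.π.onA α)} from congrArg _ hb.symm)
    obtain ⟨y', hy', h⟩ := h2 c hc
    obtain rfl : y' = y := by
      rw [hc'] at hy'
      simpa using hy'.symm
    exact ⟨c, hc, h⟩
  have rev_mk : ∀ c, S.mkA c = α → S.mkA (S.graph.rev c) = S.tree.rev α := by
    rintro c rfl
    rfl
  by_cases hr : 𝒢.base.rev b = b
  · obtain ⟨Ψ, Ψ', hΨ, h1, h2⟩ := S.adhesion_self α b hr hb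
    refine ⟨fun y => ⟨𝒢.base.t b, Ψ y⟩, fun y => ⟨𝒢.base.t b, Ψ' y⟩, ?_, fun c hc => ?_⟩
    · rcases hΨ with ⟨⟨g, hg, h⟩, ⟨g', hg', h'⟩⟩ | ⟨⟨g, hg, h⟩, ⟨g', hg', h'⟩⟩ <;>
        obtain ⟨γ, hγ⟩ := 𝒢.exists_move hg <;> obtain ⟨γ', hγ'⟩ := 𝒢.exists_move hg'
      · refine ⟨γ, γ', _, _, Or.inr ⟨hr, Or.inl ⟨rfl, rfl⟩⟩, fun y => ?_, fun y => ?_⟩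
        · exact (congrArg _ (h y)).trans (hγ _).symm
        · rw [𝒢.embRev_of_self hr]
          exact (congrArg _ (h' y)).trans (hγ' _).symm
      · refine ⟨γ, γ', _, _, Or.inr ⟨hr, Or.inr ⟨rfl, rfl⟩⟩, fun y => ?_, fun y => ?_⟩
        · exact (congrArg _ (h y)).trans (hγ _).symm
        · rw [𝒢.embRev_of_self hr]
          exact (congrArg _ (h' y)).trans (hγ' _).symm
    · obtain ⟨y, hy, hy'⟩ := h1 c hc
      obtain ⟨y₂, hy₂, hy₂'⟩ := h2 _ (rev_mk c hc)
      rw [S.pA_rev, hy] at hy₂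
      obtain rfl : y = y₂ := by simpa using hy₂
      rw [S.graph.t_rev] at hy₂'
      exact ⟨y, hy, hy', hy₂'⟩
  · have hb' : S.π.onA (S.tree.rev α) = 𝒢.base.rev b := by rw [← S.π.rev_onA, hb]
    subst hb
    obtain ⟨Ψ, ⟨g, hg, h⟩, h1⟩ := S.adhesion α hr
    obtain ⟨Ψ', ⟨g', hg', h'⟩, h2⟩ := S.adhesion (S.tree.rev α) (by
      rw [hb', 𝒢.base.rev_rev]
      exact fun h => hr h.symm)
    obtain ⟨γ, hγ⟩ := 𝒢.exists_move hg
    obtain ⟨γ', hγ'⟩ := 𝒢.exists_move hg'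
    refine ⟨fun y => 𝒢.move γ (𝒢.emb _ y), fun y => 𝒢.move γ' (𝒢.embRev _ y),
      ⟨γ, γ', 1, 1, Or.inl ⟨hr, rfl, rfl⟩, fun _ => rfl, fun _ => rfl⟩, fun c hc => ?_⟩
    obtain ⟨y, hy, hy'⟩ := h1 c hc
    obtain ⟨y₂, hy₂, hy₂'⟩ := h2 _ (rev_mk c hc)
    rw [S.pA_rev, hy] at hy₂
    refine ⟨y, hy, ?_, ?_⟩
    · rw [hy', h]
      exact (hγ _).symm
    · change _ = 𝒢.move γ' (𝒢.embRev _ y)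
      rw [𝒢.embRev_eq hb' y y₂ hy₂, emb, hγ', ← h', ← hy₂', S.graph.t_rev]

/-- The set of colours of the termini of the arcs in an arc bundle. -/
def img (α : S.tree.A) : Set (Σ k, 𝒢.X k) := (fun c => S.pV (S.graph.t c)) '' {c | S.mkA c = α}

variable {S} in
theorem img_eq_range {α : S.tree.A} {e : 𝒢.base.Edge} {F F' : 𝒢.Y e → Σ k, 𝒢.X k}
    (h₁ : ∀ c, S.mkA c = α → ∃ y, S.pA c = ⟨e, y⟩ ∧ S.pV (S.graph.t c) = F y ∧
      S.pV (S.graph.o c) = F' y)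
    (h₂ : ∀ y, ∃ c, S.mkA c = α ∧ S.pV (S.graph.t c) = F y ∧ S.pV (S.graph.o c) = F' y) :
    S.img α = Set.range F := by
  ext q
  constructor
  · rintro ⟨c, hc, rfl⟩
    obtain ⟨y, -, hy, -⟩ := h₁ c hc
    exact ⟨y, hy.symm⟩
  · rintro ⟨y, rfl⟩
    obtain ⟨c, hc, hy, -⟩ := h₂ y
    exact ⟨c, hc, hy⟩

theorem exists_img_eq (α : S.tree.A) :
    ∃ γ, S.img α = 𝒢.move γ '' Set.range (𝒢.emb (S.π.onA α)) := by
  obtain ⟨F, F', hF, h1, h2⟩ := S.exists_chart α _ rfl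
  rw [img_eq_range h1 h2]
  exact hF.range_eq

theorem image_move_range_emb (b : 𝒢.base.A) (γ : ∀ k, 𝒢.G k) :
    𝒢.move γ '' Set.range (𝒢.emb b) =
      Sigma.mk (𝒢.base.t b) '' ((γ (𝒢.base.t b)).1 '' Set.range (𝒢.Φ b)) := by
  simp only [← Set.range_comp]
  rfl

theorem exists_adhesionSet (α : S.tree.A) :
    ∃ B, 𝒢.IsAdhesionSet (S.π.onA α) B ∧ S.img α = Sigma.mk _ '' B := by
  obtain ⟨γ, hγ⟩ := S.exists_img_eq α
  exact ⟨_, ⟨_, (γ _).2, rfl⟩, hγ.trans (image_move_range_emb _ γ)⟩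

theorem t_onA (α : S.tree.A) : 𝒢.base.t (S.π.onA α) = S.π.onV (S.tree.t α) := S.π.t_onA α

theorem o_onA (α : S.tree.A) : 𝒢.base.o (S.π.onA α) = S.π.onV (S.tree.o α) := S.π.o_onA α

/-- This is the uniqueness half of condition 5. -/
theorem star_ext {α β : S.tree.A} (ht : S.tree.t α = S.tree.t β)
    (hπ : S.π.onA α = S.π.onA β) (hi : S.img α = S.img β) : α = β := by
  obtain ⟨B, hB, hB'⟩ := S.exists_adhesionSet β
  exact (S.adhesion_unique (S.tree.t β) (S.π.onA β) (S.t_onA β) B hB).unique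
    ⟨hπ, ht, hi.trans hB'⟩ ⟨rfl, rfl, hB'⟩

theorem exists_star (x : S.tree.V) (b : 𝒢.base.A) (hb : 𝒢.base.t b = S.π.onV x)
    (γ : ∀ k, 𝒢.G k) :
    ∃ α, S.tree.t α = x ∧ S.π.onA α = b ∧ S.img α = 𝒢.move γ '' Set.range (𝒢.emb b) := by
  obtain ⟨α, ⟨h1, h2, h3⟩, -⟩ := S.adhesion_unique x b hb _ ⟨_, (γ _).2, rfl⟩
  exact ⟨α, h2, h1, h3.trans (image_move_range_emb b γ).symm⟩

/-- Translates of adhesion sets are adhesion sets, so the existence half of condition 5 supplies the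
image of an arc under a prescribed local action. -/
theorem exists_star_translate (x : S.tree.V) (α : S.tree.A) (hx : S.π.onV x = S.π.onV (S.tree.t α))
    (γ : ∀ k, 𝒢.G k) :
    ∃ β, S.tree.t β = x ∧ S.π.onA β = S.π.onA α ∧ S.img β = 𝒢.move γ '' S.img α := by
  obtain ⟨γ₀, h₀⟩ := S.exists_img_eq α
  obtain ⟨β, h1, h2, h3⟩ := S.exists_star x (S.π.onA α) ((S.t_onA α).trans hx.symm) (γ * γ₀)
  refine ⟨β, h1, h2, ?_⟩
  rw [h3, h₀, map_mul, Equiv.Perm.coe_mul, Set.image_comp]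

/-- Within a bundle the colour of the terminus determines the colour of the arc, because adhesion
maps are injective, and the colour determines the arc. -/
theorem arc_ext {c d : S.graph.A} (ho : S.graph.o c = S.graph.o d)
    (ht : S.graph.t c = S.graph.t d) : c = d := by
  have h : S.mkA c = S.mkA d := S.mkA_eq_iff.2 ⟨congrArg _ ho, congrArg _ ht⟩
  obtain ⟨F, F', hF, h1, -⟩ := S.exists_chart (S.mkA d) _ rfl
  obtain ⟨y, hp, hy, -⟩ := h1 c h
  obtain ⟨y₂, hp₂, hy₂, -⟩ := h1 d rfl
  rw [ht, hy₂] at hy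
  obtain rfl := hF.injective hy
  exact (S.pA_bijOn (S.mkA d)).injOn h rfl (hp.trans hp₂.symm)

theorem tree_adj (α : S.tree.A) :
    S.tree.toMultiDigraph.underlying.Adj (S.tree.t α) (S.tree.o α) :=
  S.tree.underlying_adj_of_ne α (S.isTree.1.1 α)

theorem surjective_onV : Function.Surjective S.π.onV := by
  have : Nonempty S.tree.V := S.isTree.2.connected.nonempty
  refine 𝒢.connected.surjective_of_lift S.π.onV fun x k h => ?_
  obtain ⟨b, hb, hb'⟩ := 𝒢.base.exists_arc_of_underlying_adj h
  -- The image of `Φ_b` is itself an adhesion set, so every base arc ending below `x` lifts to an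
  -- arc ending at `x`.
  obtain ⟨α, -, h2, -⟩ := S.exists_star x b hb 1
  exact ⟨S.tree.o α, by rw [← S.o_onA, h2, hb']⟩

theorem surjective_onA : Function.Surjective S.π.onA := by
  intro b
  obtain ⟨x, hx⟩ := S.surjective_onV (𝒢.base.t b)
  obtain ⟨α, -, h2, -⟩ := S.exists_star x b hx.symm 1
  exact ⟨α, h2⟩

/-- The tree of a scaffolding is a `Star`-covering tree of the augmented base digraph. -/
theorem exists_starCovering : ∃ f : MultiDigraph.Hom S.tree.toMultiDigraph 𝒢.augmented,
    IsStarCoveringMap S.tree 𝒢.augmented f ∧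
      (∀ x, f.onV x = S.π.onV x) ∧ ∀ α, (f.onA α).1 = S.π.onA α := by
  choose B hB hB' using S.exists_adhesionSet
  let f : MultiDigraph.Hom S.tree.toMultiDigraph 𝒢.augmented :=
    { onV := S.π.onV
      onA := fun α => ⟨S.π.onA α, B α, hB α⟩
      o_onA := S.o_onA
      t_onA := S.t_onA }
  have img_eq : ∀ α (l : 𝒢.augmented.A), f.onA α = l →
      S.π.onA α = l.1 ∧ S.img α = Sigma.mk _ '' l.2.1 := by
    rintro α _ rfl
    exact ⟨rfl, hB' α⟩
  have of_img : ∀ α (l : 𝒢.augmented.A), S.π.onA α = l.1 → S.img α = Sigma.mk _ '' l.2.1 →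
      f.onA α = l := by
    rintro α ⟨b, C, hC⟩ rfl h
    have : B α = C := Set.image_injective.2 sigma_mk_injective ((hB' α).symm.trans h)
    subst this
    rfl
  have lift : ∀ x (l : 𝒢.augmented.A), 𝒢.augmented.t l = S.π.onV x →
      ∃ α, S.tree.t α = x ∧ f.onA α = l := by
    intro x l hl
    obtain ⟨α, ⟨h1, h2, h3⟩, -⟩ := S.adhesion_unique x l.1 hl l.2.1 l.2.2
    exact ⟨α, h2, of_img α l h1 h3⟩
  refine ⟨f, ⟨S.isTree, S.surjective_onV, fun l => ?_, fun x => ⟨?_, ?_, ?_⟩⟩, fun _ => rfl,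
    fun _ => rfl⟩
  · obtain ⟨x, hx⟩ := S.surjective_onV (𝒢.augmented.t l)
    obtain ⟨α, -, h⟩ := lift x l hx.symm
    exact ⟨α, h⟩
  · rintro α rfl
    exact S.t_onA α
  · intro α hα β hβ h
    obtain ⟨h1, h2⟩ := img_eq α _ h
    exact S.star_ext (hα.trans hβ.symm) h1 (h2.trans (hB' β).symm)
  · intro l hl
    exact lift x l hl

end Scaffolding

/-! ### From local actions to the universal group, its orbits and the quotient graph. -/

namespace Scaffolding

open GraphOfGroupActions

variable {𝒢 : GraphOfGroupActions.{u, v, w, z}} (S : Scaffolding.{u, v, w, z, s, r} 𝒢)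

/-- The arc bundles `α` and `β` correspond to each other if the colours at the termini are moved by
`γ` and the colours at the origins are moved by `δ`. -/
def Matches (α β : S.tree.A) (γ δ : ∀ k, 𝒢.G k) : Prop :=
  (∀ c, S.mkA c = α → ∃ d, S.mkA d = β ∧
    S.pV (S.graph.t d) = 𝒢.move γ (S.pV (S.graph.t c)) ∧
    S.pV (S.graph.o d) = 𝒢.move δ (S.pV (S.graph.o c))) ∧
  ∀ d, S.mkA d = β → ∃ c, S.mkA c = α ∧
    S.pV (S.graph.t d) = 𝒢.move γ (S.pV (S.graph.t c)) ∧
    S.pV (S.graph.o d) = 𝒢.move δ (S.pV (S.graph.o c))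

variable {S}

theorem Matches.rev {α β : S.tree.A} {γ δ : ∀ k, 𝒢.G k} (h : S.Matches α β γ δ) :
    S.Matches (S.tree.rev α) (S.tree.rev β) δ γ := by
  have key : ∀ c α, S.mkA c = S.tree.rev α → S.mkA (S.graph.rev c) = α := by
    intro c α hc
    rw [mkA_rev, hc, S.tree.rev_rev]
  refine ⟨fun c hc => ?_, fun d hd => ?_⟩
  · obtain ⟨d, hd, h1, h2⟩ := h.1 _ (key c α hc)
    refine ⟨S.graph.rev d, by rw [mkA_rev, hd], ?_, ?_⟩
    · rw [S.graph.t_rev, h2, S.graph.o_rev]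
    · rw [S.graph.o_rev, h1, S.graph.t_rev]
  · obtain ⟨c, hc, h1, h2⟩ := h.2 _ (key d β hd)
    refine ⟨S.graph.rev c, by rw [mkA_rev, hc], ?_, ?_⟩
    · rw [S.graph.t_rev, ← h2, S.graph.o_rev]
    · rw [S.graph.o_rev, ← h1, S.graph.t_rev]

theorem Matches.img_eq {α β : S.tree.A} {γ δ : ∀ k, 𝒢.G k} (h : S.Matches α β γ δ) :
    S.img β = 𝒢.move γ '' S.img α := by
  ext q
  constructor
  · rintro ⟨d, hd, rfl⟩
    obtain ⟨c, hc, h1, -⟩ := h.2 d hd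
    exact ⟨_, ⟨c, hc, rfl⟩, h1.symm⟩
  · rintro ⟨_, ⟨c, hc, rfl⟩, rfl⟩
    obtain ⟨d, hd, h1, -⟩ := h.1 c hc
    exact ⟨d, hd, h1⟩

/-- Charts for both bundles turn the transfer of local actions into a correspondence of the actual
arcs of the scaffolding. -/
theorem exists_matches {α β : S.tree.A} (hπ : S.π.onA β = S.π.onA α) (γ : ∀ k, 𝒢.G k)
    (hi : S.img β = 𝒢.move γ '' S.img α) : ∃ δ, S.Matches α β γ δ := by
  obtain ⟨F, F', hF, f1, f2⟩ := S.exists_chart α _ rfl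
  obtain ⟨D, D', hD, d1, d2⟩ := S.exists_chart β _ hπ
  rw [img_eq_range f1 f2, img_eq_range d1 d2] at hi
  obtain ⟨δ, hδ⟩ := hF.transfer hD γ hi
  refine ⟨δ, fun c hc => ?_, fun d hd => ?_⟩
  · obtain ⟨y, -, h1, h2⟩ := f1 c hc
    obtain ⟨y', hy'⟩ : 𝒢.move γ (F y) ∈ Set.range D := hi ▸ ⟨_, ⟨y, rfl⟩, rfl⟩
    obtain ⟨d, hd, h3, h4⟩ := d2 y'
    exact ⟨d, hd, by rw [h3, h1, hy'], by rw [h4, h2, hδ y y' hy']⟩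
  · obtain ⟨y', -, h1, h2⟩ := d1 d hd
    obtain ⟨_, ⟨y, rfl⟩, hy⟩ : D y' ∈ 𝒢.move γ '' Set.range F := hi ▸ ⟨y', rfl⟩
    obtain ⟨c, hc, h3, h4⟩ := f2 y
    exact ⟨c, hc, by rw [h3, h1, hy], by rw [h4, h2, hδ y y' hy.symm]⟩

variable (S)

/-- A choice of images and of local actions at all vertices of the tree that is compatible along
all arcs. -/
theorem exists_compatible_family (x₀ y₀ : S.tree.V) (h₀ : S.π.onV y₀ = S.π.onV x₀)
    (γ₀ : ∀ k, 𝒢.G k) :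
    ∃ (f : S.tree.V → S.tree.V) (fA : S.tree.A → S.tree.A) (γ : S.tree.V → ∀ k, 𝒢.G k),
      f x₀ = y₀ ∧ γ x₀ = γ₀ ∧ (∀ x, S.π.onV (f x) = S.π.onV x) ∧
      ∀ α, S.tree.t (fA α) = f (S.tree.t α) ∧ S.tree.o (fA α) = f (S.tree.o α) ∧
        S.π.onA (fA α) = S.π.onA α ∧
        S.Matches α (fA α) (γ (S.tree.t α)) (γ (S.tree.o α)) := by
  obtain ⟨σ, hσ, hP, hR⟩ := S.isTree.2.exists_section
    (St := S.tree.V × ∀ k, 𝒢.G k) (fun x a => S.π.onV a.1 = S.π.onV x)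
    -- A state consists of an image vertex and a local action. Quantifying over the arcs inside the
    -- relation makes it symmetric under reversal; simplicity of the tree later identifies `α` with
    -- the given arc.
    (fun x z a b => ∃ α β, S.tree.t α = x ∧ S.tree.o α = z ∧ S.tree.t β = a.1 ∧
      S.tree.o β = b.1 ∧ S.π.onA β = S.π.onA α ∧ S.Matches α β a.2 b.2)
    (by
      rintro x z a b ⟨α, β, h1, h2, h3, h4, h5, h6⟩
      refine ⟨S.tree.rev α, S.tree.rev β, ?_, ?_, ?_, ?_, ?_, h6.rev⟩
      · rw [S.tree.t_rev, h2]
      · rw [S.tree.o_rev, h1]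
      · rw [S.tree.t_rev, h4]
      · rw [S.tree.o_rev, h3]
      · rw [← S.π.rev_onA, ← S.π.rev_onA, h5])
    (by
      rintro x z ⟨x', γ⟩ hxz hx
      obtain ⟨α, rfl, rfl⟩ := S.tree.exists_arc_of_underlying_adj hxz
      obtain ⟨β, h1, h2, h3⟩ := S.exists_star_translate x' α hx γ
      obtain ⟨δ, hδ⟩ := exists_matches h2 γ h3
      refine ⟨(S.tree.o β, δ), ?_, α, β, rfl, rfl, h1, rfl, h2, hδ⟩
      rw [← S.o_onA, ← S.o_onA, h2])
    x₀ (y₀, γ₀) h₀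
  have arc : ∀ α, ∃ β, S.tree.t β = (σ (S.tree.t α)).1 ∧ S.tree.o β = (σ (S.tree.o α)).1 ∧
      S.π.onA β = S.π.onA α ∧ S.Matches α β (σ (S.tree.t α)).2 (σ (S.tree.o α)).2 := by
    intro α
    obtain ⟨α', β, h1, h2, h3⟩ := hR _ _ (S.tree_adj α)
    obtain rfl := S.tree_arc_ext h2 h1
    exact ⟨β, h3⟩
  choose fA hfA using arc
  exact ⟨fun x => (σ x).1, fA, fun x => (σ x).2, congrArg Prod.fst hσ, congrArg Prod.snd hσ, hP, hfA⟩

/-- Every element of `G(v)` is the local action at a vertex over `v` of an element of the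
universal group that takes this vertex to any given vertex over `v`. -/
theorem exists_mem_universalGroup (x₀ y₀ : S.tree.V) (h₀ : S.π.onV y₀ = S.π.onV x₀)
    (γ₀ : ∀ k, 𝒢.G k) :
    ∃ g ∈ S.universalGroup, ∀ y, S.mkV y = x₀ →
      S.mkV (g.1.1 y) = y₀ ∧ S.pV (g.1.1 y) = 𝒢.move γ₀ (S.pV y) := by
  obtain ⟨f, fA, γ, hx₀, hγ₀, hf, hfA⟩ := S.exists_compatible_family x₀ y₀ h₀ γ₀
  choose hft hfo hfπ hfm using hfA
  -- The map is onto on stars: pulling the adhesion set of `β` back by the inverse local action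
  -- selects the preimage arc.
  have liftA : ∀ β x, S.tree.t β = f x → ∃ α, S.tree.t α = x ∧ fA α = β := by
    intro β x hβ
    obtain ⟨α, h1, h2, h3⟩ := S.exists_star_translate x β (by rw [hβ, hf]) (γ x)⁻¹
    refine ⟨α, h1, S.star_ext ?_ ((hfπ α).trans h2) ?_⟩
    · rw [hft, h1, hβ]
    · rw [(hfm α).img_eq, h1, h3, ← Set.image_comp]
      exact (Set.image_congr fun q _ => 𝒢.move_move_inv (γ x) q).trans (Set.image_id _)
  -- Two arcs in one star with the same image have the same base arc and the same translated
  -- adhesion set, hence coincide. This gives the local injectivity needed in a tree.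
  have f_inj : Function.Injective f := by
    refine SimpleGraph.IsAcyclic.injective_of_locally_injective S.isTree.2.connected
      S.isTree.2.isAcyclic ⟨f, fun {x z} h => ?_⟩ fun x y z hx hz h => ?_
    · obtain ⟨α, rfl, rfl⟩ := S.tree.exists_arc_of_underlying_adj h
      rw [← hft, ← hfo]
      exact S.tree_adj _
    · obtain ⟨α, hα, rfl⟩ := S.tree.exists_arc_of_underlying_adj hx
      obtain ⟨β, hβ, rfl⟩ := S.tree.exists_arc_of_underlying_adj hz
      have ht : S.tree.t α = S.tree.t β := hα.trans hβ.symm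
      have e : fA α = fA β := S.tree_arc_ext (by rw [hfo, hfo]; exact h) (by rw [hft, hft, ht])
      rw [S.star_ext ht (by rw [← hfπ, e, hfπ]) ?_]
      have := (hfm α).img_eq
      rw [e, (hfm β).img_eq, ht] at this
      exact (Set.image_injective.2 (𝒢.move _).injective this).symm
  have f_surj : Function.Surjective f := by
    have : Nonempty S.tree.V := ⟨x₀⟩
    refine S.isTree.2.connected.surjective_of_lift f fun x w h => ?_
    obtain ⟨β, hβ, rfl⟩ := S.tree.exists_arc_of_underlying_adj h
    obtain ⟨α, -, rfl⟩ := liftA β x hβ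
    exact ⟨_, (hfo α).symm⟩
  -- The lift to the scaffolding is forced: bundles follow `f` and colours follow the local actions.
  have vertex : ∀ y, ∃ y', S.mkV y' = f (S.mkV y) ∧
      S.pV y' = 𝒢.move (γ (S.mkV y)) (S.pV y) := fun y =>
    S.exists_vertex _ _ (by rw [move_fst, S.pV_fst, hf])
  choose gV hgV hgV' using vertex
  have gV_eq : ∀ y y', S.mkV y' = f (S.mkV y) →
      S.pV y' = 𝒢.move (γ (S.mkV y)) (S.pV y) → y' = gV y := fun y y' h1 h2 =>
    S.vertex_ext (h1.trans (hgV y).symm) (h2.trans (hgV' y).symm)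
  have gV_bij : Function.Bijective gV := by
    constructor
    · intro y y' h
      have h1 : S.mkV y = S.mkV y' := f_inj (by rw [← hgV, ← hgV, h])
      have h2 := hgV' y
      rw [h, hgV', h1] at h2
      exact S.vertex_ext h1 ((𝒢.move _).injective h2).symm
    · intro y'
      obtain ⟨x, hx⟩ := f_surj (S.mkV y')
      obtain ⟨y, rfl, hy⟩ := S.exists_vertex x (𝒢.move (γ x)⁻¹ (S.pV y'))
        (by rw [move_fst, S.pV_fst, ← hx, hf])
      exact ⟨y, (gV_eq y y' hx.symm (by rw [hy, move_move_inv])).symm⟩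
  have ends : ∀ c d, S.mkA d = fA (S.mkA c) →
      S.pV (S.graph.t d) = 𝒢.move (γ (S.mkV (S.graph.t c))) (S.pV (S.graph.t c)) →
      S.pV (S.graph.o d) = 𝒢.move (γ (S.mkV (S.graph.o c))) (S.pV (S.graph.o c)) →
      S.graph.t d = gV (S.graph.t c) ∧ S.graph.o d = gV (S.graph.o c) := by
    intro c d h h1 h2
    refine ⟨gV_eq _ _ ?_ h1, gV_eq _ _ ?_ h2⟩
    · rw [mkV_t, mkV_t, h, hft]
    · rw [mkV_o, mkV_o, h, hfo]
  have arc : ∀ c, ∃ d, S.mkA d = fA (S.mkA c) ∧ S.graph.t d = gV (S.graph.t c) ∧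
      S.graph.o d = gV (S.graph.o c) := by
    intro c
    obtain ⟨d, hd, h1, h2⟩ := (hfm (S.mkA c)).1 c rfl
    exact ⟨d, hd, ends c d hd h1 h2⟩
  choose gA hgA hgAt hgAo using arc
  have gA_bij : Function.Bijective gA := by
    constructor
    · intro c d h
      refine S.arc_ext (gV_bij.1 ?_) (gV_bij.1 ?_)
      · rw [← hgAo, ← hgAo, h]
      · rw [← hgAt, ← hgAt, h]
    · intro d
      obtain ⟨y, hy⟩ := gV_bij.2 (S.graph.t d)
      obtain ⟨α, -, hα⟩ := liftA (S.mkA d) (S.mkV y) (by rw [← hgV, hy, mkV_t])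
      obtain ⟨c, rfl, h1, h2⟩ := (hfm α).2 d hα.symm
      obtain ⟨ht, ho⟩ := ends c d hα.symm h1 h2
      exact ⟨c, S.arc_ext ((hgAo c).trans ho.symm) ((hgAt c).trans ht.symm)⟩
  refine ⟨⟨(Equiv.ofBijective gV gV_bij, Equiv.ofBijective gA gA_bij), fun c =>
    ⟨hgAo c, hgAt c, S.arc_ext ?_ ?_⟩⟩, ⟨⟨fun x y => ?_, fun x => ?_, fun c => ?_⟩, fun x => ?_⟩,
    ?_⟩
  · change S.graph.o (S.graph.rev (gA c)) = S.graph.o (gA (S.graph.rev c))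
    rw [S.graph.o_rev, hgAo, S.graph.o_rev, hgAt]
  · change S.graph.t (S.graph.rev (gA c)) = S.graph.t (gA (S.graph.rev c))
    rw [S.graph.t_rev, hgAt, S.graph.t_rev, hgAo]
  · change S.rel (gV x) (gV y) ↔ S.rel x y
    rw [← mkV_eq_iff, ← mkV_eq_iff, hgV, hgV, f_inj.eq_iff]
  · change S.π.onV (S.mkV (gV x)) = _
    rw [hgV, hf]
  · change S.π.onA (S.mkA (gA c)) = _
    rw [hgA, hfπ]
  · refine ⟨_, (γ x (S.π.onV x)).2, fun y hy => ?_⟩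
    have h := S.pV_fst y
    have h' := hgV' y
    change ∃ c, S.pV y = _ ∧ S.pV (gV y) = _
    rw [hy] at h h'
    rw [h']
    generalize S.pV y = q at h
    obtain ⟨k, c⟩ := q
    dsimp only at h
    subst h
    exact ⟨c, rfl, rfl⟩
  · rintro y rfl
    exact ⟨(hgV y).trans hx₀, (hgV' y).trans (by rw [hγ₀])⟩

theorem orbit_vertices_iff (x y : S.tree.V) :
    (∃ g, (S.treeAction g).1.1 x = y) ↔ S.π.onV x = S.π.onV y := by
  constructor
  · rintro ⟨g, rfl⟩
    obtain ⟨v, rfl⟩ := S.mkV_surjective x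
    exact (g.2.1.2.1 v).symm
  · intro h
    obtain ⟨g, hg, hg'⟩ := S.exists_mem_universalGroup x y h.symm 1
    obtain ⟨v, rfl⟩ := S.mkV_surjective x
    exact ⟨⟨g, hg⟩, (hg' v rfl).1⟩

/-- Both adhesion sets are translates of the standard one, so `γ₂ * γ₁⁻¹` carries the first to the
second. An element with this local action, taking terminus to terminus, sends `α` to an arc with the
terminus, base arc and adhesion set of `β`. -/
theorem orbit_arcs_iff (α β : S.tree.A) :
    (∃ g, (S.treeAction g).1.2 α = β) ↔ S.π.onA α = S.π.onA β := by
  constructor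
  · rintro ⟨g, rfl⟩
    obtain ⟨c, rfl⟩ := S.mkA_surjective α
    exact (g.2.1.2.2 c).symm
  · intro h
    obtain ⟨γ₁, h₁⟩ := S.exists_img_eq α
    obtain ⟨γ₂, h₂⟩ := S.exists_img_eq β
    obtain ⟨g, hg, hg'⟩ := S.exists_mem_universalGroup (S.tree.t α) (S.tree.t β)
      (by rw [← S.t_onA, ← S.t_onA, h]) (γ₂ * γ₁⁻¹)
    have hi : S.img β = 𝒢.move (γ₂ * γ₁⁻¹) '' S.img α := by
      rw [h₁, h₂, h, ← Set.image_comp]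
      refine Set.image_congr fun q _ => ?_
      rw [Function.comp_apply, move_mul_apply, move_inv_move]
    refine ⟨⟨g, hg⟩, ?_⟩
    have hmk : ∀ c, S.mkA c = α → (S.treeAction ⟨g, hg⟩).1.2 α = S.mkA (g.1.2 c) := by
      rintro c rfl
      rfl
    have ht : S.tree.t ((S.treeAction ⟨g, hg⟩).1.2 α) = S.tree.t β := by
      obtain ⟨c, hc⟩ := S.mkA_surjective α
      rw [hmk c hc, ← mkV_t, (g.2 c).2.1]
      exact (hg' _ (by rw [mkV_t, hc])).1
    refine S.star_ext ht ?_ ?_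
    · obtain ⟨c, hc⟩ := S.mkA_surjective α
      rw [hmk c hc, hg.1.2.2, hc, h]
    · rw [hi]
      have color : ∀ c, S.mkA c = α →
          S.pV (S.graph.t (g.1.2 c)) = 𝒢.move (γ₂ * γ₁⁻¹) (S.pV (S.graph.t c)) := by
        intro c hc
        rw [(g.2 c).2.1]
        exact (hg' _ (by rw [mkV_t, hc])).2
      ext q
      constructor
      · rintro ⟨d, hd, rfl⟩
        obtain ⟨c, rfl⟩ := g.1.2.surjective d
        have hc : S.mkA c = α := (S.treeAction ⟨g, hg⟩).1.2.injective hd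
        exact ⟨_, ⟨c, hc, rfl⟩, (color c hc).symm⟩
      · rintro ⟨_, ⟨c, hc, rfl⟩, rfl⟩
        exact ⟨g.1.2 c, (hmk c hc).symm, color c hc⟩

/-- The projection of a scaffolding induces an isomorphism from the quotient of the tree by the
universal group onto the base graph. -/
theorem exists_orbitGraph_iso : ∃ e : SerreGraph.Iso (S.tree.orbitGraph S.treeAction) 𝒢.base,
    (∀ x : S.tree.V, e.onV (Quotient.mk _ x) = S.π.onV x) ∧
      ∀ α : S.tree.A, e.onA (Quotient.mk _ α) = S.π.onA α := by
  have hV : Function.Bijective (Quotient.lift (s := (S.tree.orbitEquivalence S.treeAction).relV)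
      S.π.onV fun x y h => (S.orbit_vertices_iff x y).1 h) := by
    constructor
    · intro x y
      induction x using Quotient.inductionOn
      induction y using Quotient.inductionOn
      exact fun h => Quotient.sound ((S.orbit_vertices_iff _ _).2 h)
    · intro k
      obtain ⟨x, hx⟩ := S.surjective_onV k
      exact ⟨Quotient.mk _ x, hx⟩
  have hA : Function.Bijective (Quotient.lift (s := (S.tree.orbitEquivalence S.treeAction).relA)
      S.π.onA fun x y h => (S.orbit_arcs_iff x y).1 h) := by
    constructor
    · intro x y
      induction x using Quotient.inductionOn
      induction y using Quotient.inductionOn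
      exact fun h => Quotient.sound ((S.orbit_arcs_iff _ _).2 h)
    · intro b
      obtain ⟨α, hα⟩ := S.surjective_onA b
      exact ⟨Quotient.mk _ α, hα⟩
  refine ⟨⟨Equiv.ofBijective _ hV, Equiv.ofBijective _ hA, fun α => ?_, fun α => ?_, fun α => ?_⟩,
    fun _ => rfl, fun _ => rfl⟩
  all_goals induction α using Quotient.inductionOn with | h α => ?_
  · exact S.π.o_onA α
  · exact S.π.t_onA α
  · exact S.π.rev_onA α

end Scaffolding

/-! ### Existence: the standard scaffolding built from reduced words. -/

namespace GraphOfGroupActions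

variable (𝒢 : GraphOfGroupActions.{u, v, w, z})

/-- The arcs of the augmented base digraph, lifted to a common universe. -/
abbrev Label := ULift.{max u z, max v w} 𝒢.augmented.A

variable {𝒢}

/-- The label of the arc from the terminus to the origin of an arc labelled `l` that points towards
the root. -/
def Label.back (l : 𝒢.Label) : 𝒢.Label :=
  ⟨⟨𝒢.base.rev l.down.1, Set.range (𝒢.Φ (𝒢.base.rev l.down.1)), 1, one_mem _, by simp⟩⟩

/-- The base vertex below the vertex of the tree that is coded by a word. -/
def wordEnd (v₀ : 𝒢.base.V) : List 𝒢.Label → 𝒢.base.V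
  | [] => v₀
  | l :: _ => 𝒢.base.o l.down.1

/-- Prolonging the word by `l` does not return to the previous vertex. -/
def IsFresh (l : 𝒢.Label) : List 𝒢.Label → Prop
  | [] => True
  | m :: _ => l ≠ m.back

/-- The words that code the vertices of the tree, as paths without backtracking to the root. -/
def IsReduced (v₀ : 𝒢.base.V) : List 𝒢.Label → Prop
  | [] => True
  | l :: w => 𝒢.base.t l.down.1 = wordEnd v₀ w ∧ IsFresh l w ∧ IsReduced v₀ w

/-- A chosen adhesion map whose image is the adhesion set of the label. -/
noncomputable def upMap (l : 𝒢.augmented.A) (y : 𝒢.Y (𝒢.base.edge l.1)) : 𝒢.X (𝒢.base.t l.1) :=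
  l.2.2.choose (𝒢.Φ l.1 y)

theorem isAdhesionMap_upMap (l : 𝒢.augmented.A) : 𝒢.IsAdhesionMap l.1 (upMap l) :=
  ⟨_, l.2.2.choose_spec.1, fun _ => rfl⟩

theorem range_upMap (l : 𝒢.augmented.A) : Set.range (upMap l) = l.2.1 := by
  rw [l.2.2.choose_spec.2, ← Set.range_comp]
  rfl

open Classical in
/-- The map at the reverse of the arc `b`, twisted if `b` is self-reverse. -/
noncomputable def downMap (b : 𝒢.base.A) (y : 𝒢.Y (𝒢.base.edge b)) : Σ k, 𝒢.X k :=
  if h : 𝒢.base.rev b = b then 𝒢.embRev b (𝒢.agent b h y) else 𝒢.embRev b y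

theorem downMap_fst (b : 𝒢.base.A) (y : 𝒢.Y (𝒢.base.edge b)) :
    (downMap b y).1 = 𝒢.base.o b := by
  unfold downMap
  split_ifs <;> exact 𝒢.base.t_rev b

theorem range_downMap (b : 𝒢.base.A) :
    Set.range (downMap b) = Set.range (𝒢.emb (𝒢.base.rev b)) := by
  rw [← 𝒢.range_embRev]
  by_cases h : 𝒢.base.rev b = b
  · rw [← (𝒢.agent b h).surjective.range_comp (𝒢.embRev b)]
    exact congrArg Set.range (funext fun y => dif_pos h)
  · exact congrArg Set.range (funext fun y => dif_neg h)

variable (v₀ : 𝒢.base.V)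

/-- The vertices of the standard scaffolding. -/
def ScaffoldVertex : Type max u v w z :=
  {x : List 𝒢.Label × Σ k, 𝒢.X k // IsReduced v₀ x.1 ∧ x.2.1 = wordEnd v₀ x.1}

/-- The arcs of the standard scaffolding; the arcs with value `true` point towards the root. -/
def ScaffoldArc : Type max u v w z :=
  Σ x : {x : 𝒢.Label × List 𝒢.Label // IsReduced v₀ (x.1 :: x.2)},
    𝒢.Y (𝒢.base.edge x.1.1.down.1) × Bool

variable {v₀}

/-- The terminus of an arc of the standard scaffolding. -/
noncomputable def ScaffoldArc.target : ScaffoldArc v₀ → ScaffoldVertex v₀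
  | ⟨x, y, true⟩ => ⟨(x.1.2, ⟨_, upMap x.1.1.down y⟩), x.2.2.2, x.2.1⟩
  | ⟨x, y, false⟩ => ⟨(x.1.1 :: x.1.2, downMap x.1.1.down.1 y), x.2, downMap_fst _ y⟩

/-- The reverse of an arc of the standard scaffolding. -/
def ScaffoldArc.reverse : ScaffoldArc v₀ → ScaffoldArc v₀
  | ⟨x, y, b⟩ => ⟨x, y, !b⟩

theorem ScaffoldArc.reverse_reverse (c : ScaffoldArc v₀) : c.reverse.reverse = c := by
  obtain ⟨x, y, b⟩ := c
  cases b <;> rfl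

/-- The label of an arc of the standard scaffolding. -/
def ScaffoldArc.label : ScaffoldArc v₀ → 𝒢.Label
  | ⟨x, _, true⟩ => x.1.1
  | ⟨x, _, false⟩ => x.1.1.back

variable (v₀)

/-- The underlying graph of the standard scaffolding. -/
noncomputable def scaffoldGraph : SerreGraph.{max u v w z, max u v w z} where
  V := ScaffoldVertex v₀
  A := ScaffoldArc v₀
  o c := c.reverse.target
  t := ScaffoldArc.target
  rev := ScaffoldArc.reverse
  rev_rev := ScaffoldArc.reverse_reverse
  t_rev _ := rfl

/-- Two vertices of the standard scaffolding are equivalent if they have the same word. -/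
noncomputable def scaffoldRel : Setoid (scaffoldGraph v₀).V := Setoid.ker fun x : ScaffoldVertex v₀ => x.1.1

/-- The tree of the standard scaffolding. -/
noncomputable abbrev scaffoldTree : SerreGraph.{max u v w z, max u v w z} :=
  (scaffoldGraph v₀).quotient (.ofVertices _ (scaffoldRel v₀))

variable {v₀}

/-- The word that codes a vertex of the tree. -/
noncomputable def code : (scaffoldTree v₀).V → List 𝒢.Label :=
  Quotient.lift (fun x : ScaffoldVertex v₀ => x.1.1) fun _ _ h => h

theorem code_injective : Function.Injective (code (v₀ := v₀)) := by
  intro x y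
  induction x using Quotient.inductionOn
  induction y using Quotient.inductionOn
  exact fun h => Quotient.sound h

theorem code_reduced (x : (scaffoldTree v₀).V) : IsReduced v₀ (code x) := by
  induction x using Quotient.inductionOn with
  | h x => exact x.2.1

/-- Passing to the tree forgets only the colour of an arc. Arcs of opposite directions cannot be
equivalent, since the word lengths at their ends would contradict each other. -/
theorem mk_arc_eq_iff {c d : ScaffoldArc v₀} :
    (Quotient.mk _ c : (scaffoldTree v₀).A) = Quotient.mk _ d ↔ c.1 = d.1 ∧ c.2.2 = d.2.2 := by
  refine Quotient.eq.trans ?_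
  change c.reverse.target.1.1 = d.reverse.target.1.1 ∧ c.target.1.1 = d.target.1.1 ↔ _
  obtain ⟨⟨⟨l, w⟩, hx⟩, y, b⟩ := c
  obtain ⟨⟨⟨l', w'⟩, hx'⟩, y', b'⟩ := d
  cases b <;> cases b' <;>
    simp only [ScaffoldArc.target, ScaffoldArc.reverse, Bool.not_true, Bool.not_false,
      Subtype.mk.injEq, Prod.mk.injEq, List.cons.injEq, and_true, and_false, reduceCtorEq,
      iff_false]
  · tauto
  · rintro ⟨rfl, h⟩
    have := congrArg List.length h
    simp only [List.length_cons] at this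
    omega
  · rintro ⟨rfl, h⟩
    have := congrArg List.length h
    simp only [List.length_cons] at this
    omega
  · tauto

theorem eq_of_mk_arc_eq {x x' : {x : 𝒢.Label × List 𝒢.Label // IsReduced v₀ (x.1 :: x.2)}}
    {y : 𝒢.Y (𝒢.base.edge x.1.1.down.1)} {y' : 𝒢.Y (𝒢.base.edge x'.1.1.down.1)} {b b' : Bool}
    (h : (Quotient.mk _ (⟨x, y, b⟩ : ScaffoldArc v₀) : (scaffoldTree v₀).A) =
      Quotient.mk _ (⟨x', y', b'⟩ : ScaffoldArc v₀)) : x = x' ∧ b = b' :=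
  mk_arc_eq_iff.1 h

theorem label_eq_of_mk_eq {c d : ScaffoldArc v₀}
    (h : (Quotient.mk _ c : (scaffoldTree v₀).A) = Quotient.mk _ d) : c.label = d.label := by
  obtain ⟨x, y, b⟩ := c
  obtain ⟨x', y', b'⟩ := d
  obtain ⟨h1, h2⟩ := mk_arc_eq_iff.1 h
  dsimp only at h1 h2
  subst h1 h2
  cases b <;> rfl

theorem o_label (c : ScaffoldArc v₀) :
    𝒢.base.o c.label.down.1 = wordEnd v₀ c.reverse.target.1.1 := by
  obtain ⟨⟨⟨l, w⟩, hx⟩, y, b⟩ := c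
  cases b
  · exact (𝒢.base.o_rev _).trans hx.1
  · rfl

theorem label_reverse_fst (c : ScaffoldArc v₀) :
    𝒢.base.rev c.label.down.1 = c.reverse.label.down.1 := by
  obtain ⟨x, y, b⟩ := c
  cases b
  · exact 𝒢.base.rev_rev _
  · rfl

theorem t_label (c : ScaffoldArc v₀) :
    𝒢.base.t c.label.down.1 = wordEnd v₀ c.target.1.1 := by
  have := o_label c.reverse
  rwa [c.reverse_reverse, ← label_reverse_fst, 𝒢.base.o_rev] at this

theorem edge_label (c : ScaffoldArc v₀) :
    𝒢.base.edge c.label.down.1 = 𝒢.base.edge c.1.1.1.down.1 := by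
  obtain ⟨x, y, b⟩ := c
  cases b
  · exact 𝒢.base.edge_rev _
  · rfl

theorem code_target (c : ScaffoldArc v₀) :
    (∃ l, c.target.1.1 = l :: c.reverse.target.1.1) ∨
      ∃ l, c.reverse.target.1.1 = l :: c.target.1.1 := by
  obtain ⟨x, y, b⟩ := c
  cases b
  · exact Or.inl ⟨_, rfl⟩
  · exact Or.inr ⟨_, rfl⟩

theorem code_target_ne (c : ScaffoldArc v₀) : c.reverse.target.1.1 ≠ c.target.1.1 := by
  intro h
  rcases code_target c with ⟨l, hl⟩ | ⟨l, hl⟩ <;>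
  · rw [h] at hl
    simpa using congrArg List.length hl

theorem exists_arc {l : 𝒢.Label} {w : List 𝒢.Label} (h : IsReduced v₀ (l :: w)) (b : Bool) :
    ∃ c : ScaffoldArc v₀, c.1.1 = (l, w) ∧ c.2.2 = b := by
  obtain ⟨y⟩ := 𝒢.Y_nonempty (𝒢.base.edge l.down.1)
  exact ⟨⟨⟨(l, w), h⟩, y, b⟩, rfl, rfl⟩

theorem scaffoldTree_isTree : (scaffoldTree v₀).IsTree := by
  refine ⟨⟨fun α => ?_, fun α β => ?_⟩, SimpleGraph.isTree_of_list_code code code_injective ?_ ?_ ?_⟩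
  · induction α using Quotient.inductionOn with
    | h c => exact fun h => code_target_ne c (congrArg code h)
  · induction α using Quotient.inductionOn
    induction β using Quotient.inductionOn
    intro h
    exact Quotient.sound ⟨congrArg code (Prod.mk.inj h).1, congrArg code (Prod.mk.inj h).2⟩
  · obtain ⟨c⟩ := 𝒢.X_nonempty v₀
    exact ⟨Quotient.mk _ (⟨([], ⟨v₀, c⟩), trivial, rfl⟩ : ScaffoldVertex v₀), rfl⟩
  · intro x y hxy
    obtain ⟨α, rfl, rfl⟩ := (scaffoldTree v₀).exists_arc_of_underlying_adj hxy
    induction α using Quotient.inductionOn with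
    | h c => exact code_target c
  · intro x l w hx
    -- Since `Y` is non-empty, a word and its tail are joined by an actual arc.
    obtain ⟨y⟩ := 𝒢.Y_nonempty (𝒢.base.edge l.down.1)
    let c : ScaffoldArc v₀ := ⟨⟨(l, w), hx ▸ code_reduced x⟩, y, false⟩
    have hc : (scaffoldTree v₀).t (Quotient.mk _ c) = x := code_injective hx.symm
    refine ⟨(scaffoldTree v₀).o (Quotient.mk _ c), ?_, rfl⟩
    rw [← hc]
    exact (scaffoldTree v₀).underlying_adj_of_ne _ fun h => code_target_ne c (congrArg code h)

/-- The projection of the tree of the standard scaffolding. -/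
noncomputable def scaffoldProj : SerreGraph.Hom (scaffoldTree v₀) 𝒢.base where
  onV x := wordEnd v₀ (code x)
  onA := Quotient.lift (fun c : ScaffoldArc v₀ => c.label.down.1) fun _ _ h =>
    congrArg (fun l : 𝒢.Label => l.down.1) (label_eq_of_mk_eq (Quotient.sound h))
  o_onA α := by
    induction α using Quotient.inductionOn with
    | h c => exact o_label c
  t_onA α := by
    induction α using Quotient.inductionOn with
    | h c => exact t_label c
  rev_onA α := by
    induction α using Quotient.inductionOn with
    | h c => exact label_reverse_fst c

/-- A label thus records the true adhesion set of its arc. Away from the root, the twist only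
permutes `Y` and leaves the image unchanged. -/
theorem image_target (c : ScaffoldArc v₀) :
    (fun d : ScaffoldArc v₀ => d.target.1.2) ''
        {d | (Quotient.mk _ d : (scaffoldTree v₀).A) = Quotient.mk _ c} =
      Sigma.mk _ '' c.label.down.2.1 := by
  have key : (fun d : ScaffoldArc v₀ => d.target.1.2) ''
        {d | (Quotient.mk _ d : (scaffoldTree v₀).A) = Quotient.mk _ c} =
      Set.range fun y => (ScaffoldArc.target ⟨c.1, y, c.2.2⟩).1.2 := by
    ext q
    constructor
    · rintro ⟨⟨x, y, b⟩, hd, rfl⟩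
      obtain ⟨rfl, rfl⟩ := mk_arc_eq_iff.1 hd
      exact ⟨y, rfl⟩
    · rintro ⟨y, rfl⟩
      exact ⟨⟨c.1, y, c.2.2⟩, mk_arc_eq_iff.2 ⟨rfl, rfl⟩, rfl⟩
  rw [key]
  obtain ⟨x, y, b⟩ := c
  cases b
  · refine (range_downMap x.1.1.down.1).trans ?_
    exact Set.range_comp (Sigma.mk (𝒢.base.t (𝒢.base.rev x.1.1.down.1))) _
  · refine Eq.trans ?_ (congrArg _ (range_upMap x.1.1.down))
    exact Set.range_comp (Sigma.mk (𝒢.base.t x.1.1.down.1)) _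

/-- A fresh label prolongs the word, giving an arc from the longer word. The one label that is not
fresh belongs to the arc from the previous vertex. -/
theorem exists_arc_label {w : List 𝒢.Label} (hw : IsReduced v₀ w) (l : 𝒢.Label)
    (hl : 𝒢.base.t l.down.1 = wordEnd v₀ w) :
    ∃ c : ScaffoldArc v₀, c.label = l ∧ c.target.1.1 = w := by
  by_cases h : IsFresh l w
  · obtain ⟨⟨x, y, b⟩, h1, h2⟩ := exists_arc (show IsReduced v₀ (l :: w) from ⟨hl, h, hw⟩) true
    dsimp only at h1 h2
    subst h2
    exact ⟨⟨x, y, true⟩, congrArg Prod.fst h1, congrArg Prod.snd h1⟩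
  · cases w with
    | nil => exact (h trivial).elim
    | cons m w =>
      obtain ⟨⟨x, y, b⟩, h1, h2⟩ := exists_arc hw false
      dsimp only at h1 h2
      subst h2
      refine ⟨⟨x, y, false⟩, ?_, ?_⟩
      · change x.1.1.back = l
        rw [h1]
        exact (not_not.1 h).symm
      · change x.1.1 :: x.1.2 = _
        rw [h1]

/-- Reducedness excludes the only possible clash, between the arc arriving from the root's side and
one arriving from a longer word. -/
theorem mk_arc_eq_of_label {c d : ScaffoldArc v₀} (hl : c.label = d.label)
    (ht : c.target.1.1 = d.target.1.1) :
    (Quotient.mk _ c : (scaffoldTree v₀).A) = Quotient.mk _ d := by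
  rw [mk_arc_eq_iff]
  obtain ⟨⟨⟨l, w⟩, hx⟩, y, b⟩ := c
  obtain ⟨⟨⟨l', w'⟩, hx'⟩, y', b'⟩ := d
  cases b <;> cases b' <;> dsimp only [ScaffoldArc.label, ScaffoldArc.target] at hl ht
  · obtain ⟨rfl, rfl⟩ := List.cons.inj ht
    exact ⟨rfl, rfl⟩
  · subst ht
    exact (hx'.2.1 hl.symm).elim
  · subst ht
    exact (hx.2.1 hl).elim
  · subst hl ht
    exact ⟨rfl, rfl⟩

variable (v₀)

/-- The standard scaffolding of a graph of group actions with a given base vertex. -/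
noncomputable def scaffolding : Scaffolding.{u, v, w, z, max u v w z, max u v w z} 𝒢 where
  graph := scaffoldGraph v₀
  rel := scaffoldRel v₀
  isTree := scaffoldTree_isTree
  bundle_empty := code_target_ne
  π := scaffoldProj
  pV := fun x : ScaffoldVertex v₀ => x.1.2
  pA := fun c : ScaffoldArc v₀ => ⟨𝒢.base.edge c.1.1.1.down.1, c.2.1⟩
  pV_bijOn x := by
    refine ⟨?_, ?_, ?_⟩
    · rintro y rfl
      exact y.2.2
    · intro y hy y' hy' h
      have h' : y.1.1 = y'.1.1 := congrArg code (hy.trans hy'.symm)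
      exact Subtype.ext (Prod.ext h' h)
    · intro q hq
      exact ⟨⟨(code x, q), code_reduced x, hq⟩, code_injective rfl, rfl⟩
  pA_bijOn α := by
    induction α using Quotient.inductionOn with
    | h c =>
      refine ⟨?_, ?_, ?_⟩
      · intro d hd
        exact (congrArg (fun x : {x : 𝒢.Label × List 𝒢.Label // IsReduced v₀ (x.1 :: x.2)} =>
          𝒢.base.edge x.1.1.down.1) (mk_arc_eq_iff.1 hd).1).trans (edge_label c).symm
      · rintro ⟨x, y, b⟩ hd ⟨x', y', b'⟩ hd' h
        obtain ⟨rfl, rfl⟩ := mk_arc_eq_iff.1 (Eq.trans hd (Eq.symm hd'))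
        obtain rfl := eq_of_heq (Sigma.mk.inj h).2
        rfl
      · rintro ⟨e, y⟩ he
        obtain rfl : e = _ := Eq.trans he (edge_label c)
        exact ⟨⟨c.1, y, c.2.2⟩, mk_arc_eq_iff.2 ⟨rfl, rfl⟩, rfl⟩
  pA_rev c := rfl
  adhesion α := by
    induction α using Quotient.inductionOn with
    | h c =>
      obtain ⟨x, y₀, b⟩ := c
      intro h
      cases b
      · refine ⟨𝒢.Φ (𝒢.base.rev x.1.1.down.1), ⟨1, one_mem _, fun _ => rfl⟩, ?_⟩
        rintro ⟨x', y, b'⟩ hc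
        obtain ⟨rfl, rfl⟩ := eq_of_mk_arc_eq hc
        have h' : 𝒢.base.rev x'.1.1.down.1 ≠ x'.1.1.down.1 := fun e =>
          h (congrArg 𝒢.base.rev e)
        exact ⟨_, Sigma.ext (𝒢.base.edge_rev _).symm (cast_heq _ y).symm, dif_neg h'⟩
      · refine ⟨_, isAdhesionMap_upMap x.1.1.down, ?_⟩
        rintro ⟨x', y, b'⟩ hc
        obtain ⟨rfl, rfl⟩ := eq_of_mk_arc_eq hc
        exact ⟨y, rfl, rfl⟩
  adhesion_self α b hb hα := by
    induction α using Quotient.inductionOn with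
    | h c =>
      obtain ⟨x, y₀, i⟩ := c
      -- Over a self-reverse arc both directions of the edge project to the same `b`.
      obtain rfl : x.1.1.down.1 = b := by
        cases i
        · have : 𝒢.base.rev x.1.1.down.1 = b := hα
          rw [← this, 𝒢.base.rev_rev] at hb
          exact hb.trans this
        · exact hα
      have up : ∀ c : ScaffoldArc v₀, c.1 = x → c.2.2 = true →
          ∃ y, (⟨_, c.2.1⟩ : Σ e, 𝒢.Y e) = ⟨𝒢.base.edge x.1.1.down.1, y⟩ ∧
            c.target.1.2 = ⟨_, upMap x.1.1.down y⟩ := by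
        rintro ⟨x', y, i'⟩ rfl rfl
        exact ⟨y, rfl, rfl⟩
      have down : ∀ c : ScaffoldArc v₀, c.1 = x → c.2.2 = false →
          ∃ y, (⟨_, c.2.1⟩ : Σ e, 𝒢.Y e) = ⟨𝒢.base.edge x.1.1.down.1, y⟩ ∧
            c.target.1.2 = ⟨_, 𝒢.Φ x.1.1.down.1 (𝒢.agent _ hb y)⟩ := by
        rintro ⟨x', y, i'⟩ rfl rfl
        exact ⟨y, rfl, (dif_pos hb).trans (𝒢.embRev_of_self hb _)⟩
      have twisted : 𝒢.IsTwistedAdhesionMap _ hb fun y =>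
          𝒢.Φ x.1.1.down.1 (𝒢.agent _ hb y) := ⟨1, one_mem _, fun _ => rfl⟩
      cases i
      · refine ⟨_, _, Or.inr ⟨twisted, isAdhesionMap_upMap x.1.1.down⟩, fun c hc => ?_,
          fun c hc => ?_⟩
        · exact down c (mk_arc_eq_iff.1 hc).1 (mk_arc_eq_iff.1 hc).2
        · exact up c (mk_arc_eq_iff.1 hc).1 (mk_arc_eq_iff.1 hc).2
      · refine ⟨_, _, Or.inl ⟨isAdhesionMap_upMap x.1.1.down, twisted⟩, fun c hc => ?_,
          fun c hc => ?_⟩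
        · exact up c (mk_arc_eq_iff.1 hc).1 (mk_arc_eq_iff.1 hc).2
        · exact down c (mk_arc_eq_iff.1 hc).1 (mk_arc_eq_iff.1 hc).2
  adhesion_unique x b hb B hB := by
    have lbl : ∀ c : ScaffoldArc v₀, c.label.down.1 = b →
        (fun d : ScaffoldArc v₀ => d.target.1.2) ''
          {d | (Quotient.mk _ d : (scaffoldTree v₀).A) = Quotient.mk _ c} =
          Sigma.mk (𝒢.base.t b) '' B → c.label = ⟨⟨b, B, hB⟩⟩ := by
      intro c h1 h2
      rw [image_target] at h2
      generalize c.label = l at h1 h2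
      obtain ⟨⟨b', B', hB'⟩⟩ := l
      dsimp only at h1 h2
      subst h1
      obtain rfl := Set.image_injective.2 sigma_mk_injective h2
      rfl
    obtain ⟨c, hc, hc'⟩ := exists_arc_label (code_reduced x) ⟨⟨b, B, hB⟩⟩ hb
    refine ⟨Quotient.mk _ c, ⟨?_, code_injective hc', ?_⟩, ?_⟩
    · exact congrArg (fun l : 𝒢.Label => l.down.1) hc
    · refine (image_target c).trans ?_
      rw [hc]
    · intro α
      induction α using Quotient.inductionOn with
      | h d =>
        rintro ⟨h1, h2, h3⟩
        exact mk_arc_eq_of_label ((lbl d h1 h3).trans hc.symm)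
          (Eq.trans (congrArg code h2) hc'.symm)

end GraphOfGroupActions

theorem mainTheorem4 (𝒢 : GraphOfGroupActions.{u, v, w, z}) :
    -- scaffoldings exist, so that the universal group and the associated tree make sense
    Nonempty (Scaffolding.{u, v, w, z, max u v w z, max u v w z} 𝒢) ∧
    -- whichever scaffolding is used to define the universal group
    ∀ S : Scaffolding.{u, v, w, z, s, r} 𝒢,
      -- its tree is a Star-covering tree of the augmented base digraph, compatibly with `π`
      (∃ f : MultiDigraph.Hom S.tree.toMultiDigraph 𝒢.augmented,
        IsStarCoveringMap S.tree 𝒢.augmented f ∧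
          (∀ x, f.onV x = S.π.onV x) ∧ ∀ α, (f.onA α).1 = S.π.onA α) ∧
      -- the orbits of the universal group on vertices and arcs are the fibres of `π`
      (Function.Surjective S.π.onV ∧
        ∀ x y : S.tree.V, (∃ g, (S.treeAction g).1.1 x = y) ↔ S.π.onV x = S.π.onV y) ∧
      (Function.Surjective S.π.onA ∧
        ∀ α β : S.tree.A, (∃ g, (S.treeAction g).1.2 α = β) ↔ S.π.onA α = S.π.onA β) ∧
      -- the quotient graph is isomorphic to the base graph, by the map induced by `π`
      ∃ e : SerreGraph.Iso (S.tree.orbitGraph S.treeAction) 𝒢.base,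
        (∀ x : S.tree.V, e.onV (Quotient.mk _ x) = S.π.onV x) ∧
          ∀ α : S.tree.A, e.onA (Quotient.mk _ α) = S.π.onA α := by
  obtain ⟨v₀⟩ := 𝒢.connected.nonempty
  exact ⟨⟨GraphOfGroupActions.scaffolding v₀⟩, fun S => ⟨S.exists_starCovering,
    ⟨S.surjective_onV, S.orbit_vertices_iff⟩, ⟨S.surjective_onA, S.orbit_arcs_iff⟩,
    S.exists_orbitGraph_iso⟩⟩
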